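/- Let $k$ be an algebraically closed field of characteristic zero, $n\ge 0$, $S=k[x_1,\dots,x_{n+1}]$ the homogeneous coordinate ring of $\mathbb P^n$, and let $I\subseteq S$ be a homogeneous radical ideal. *Notation.* For $m\ge 0$ let $I^{(m)}=S\cap\bigcap_{Q\in\mathrm{Ass}(S/I)}(I^m)_Q$ be the $m$-th symbolic power. For a homogeneous ideal $J\subseteq S$ let $\mathrm{HF}_J(d)=\dim_k(S_d/J_d)$ be its Hilbert function, $\mathrm{HP}_J$ its Hilbert polynomial (the polynomial that agrees with $\mathrm{HF}_J(d)$ for all large integers $d$), $\mathrm{reg}(J)=\sup\{q-p:\mathrm{Tor}^S_p(J,k)_q\neq 0\}$ its Castelnuovo–Mumford regularity, and $\mathrm{gin}(J)$ its generic initial ideal with respect to the degree reverse lexicographic order with $x_1>\dots>x_{n+1}$. For an integer $t\ge 0$ put $$\mathrm{aHF}_I(t)=\lim_{m\to\infty}\frac{\mathrm{HF}_{I^{(m)}}(mt)}{m^n},$$ and for $t\in\mathbb R$ put $$\mathrm{aHP}_I(t)=\lim_{m\to\infty}\frac{\mathrm{HP}_{I^{(m)}}(mt)}{m^n},$$ whenever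 these limits exist. For $m\ge1$ let $L_m\subseteq\mathbb R^n$ be the union of the orthants $(\alpha_1,\dots,\alpha_n)+\mathbb R^n_{\ge 0}$ over all monomials $x_1^{\alpha_1}\cdots x_{n+1}^{\alpha_{n+1}}\in\mathrm{gin}(I^{(m)})$. Let $$\Gamma(I)=\overline{\bigcap_{m\ge 1}\Bigl(\mathbb R^n_{\ge 0}\setminus\tfrac1m\mathrm{conv}(L_m)\Bigr)},\qquad T_t=\{x\in\mathbb R^n_{\ge 0}: x_1+\dots+x_n\le t\}.$$ **Theorem.** Suppose that $I$ has linearly bounded symbolic regularity, that is, there are real constants $a,b>0$ with $\mathrm{reg}(I^{(m)})\le am+b$ for all sufficiently large $m$. Then the limit $\mathrm{aHP}_I(t)$ exists for every real $t$, and for all sufficiently large integers $t$ the limit $\mathrm{aHF}_I(t)$ exists and $$\mathrm{aHP}_I(t)=\mathrm{aHF}_I(t)=\mathrm{vol}\bigl(\Gamma(I)\cap T_t\bigr).$$ -/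

import Mathlib

open Filter Topology MeasureTheory

attribute [local instance] MvPolynomial.gradedAlgebra

noncomputable section

namespace AsymptoticHilbert

variable {k : Type*} [Field k] {n : ℕ}

/-- The homogeneous coordinate ring `k[x_1, …, x_{n+1}]` of projective `n`-space; the variable
`x_{i+1}` is `MvPolynomial.X i`, and the last variable `x_{n+1}` is `X (Fin.last n)`. -/
abbrev CoordRing (k : Type*) [Field k] (n : ℕ) : Type _ := MvPolynomial (Fin (n + 1)) k

/-! ### Symbolic powers -/

/-- The `m`-th symbolic power `I^(m)`: the intersection, over the associated primes `Q` of `S / I`,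
of the contractions to `S` of the localized ideals `(I ^ m)_Q`. -/
def symbolicPower (I : Ideal (CoordRing k n)) (m : ℕ) : Ideal (CoordRing k n) :=
  ⨅ Q : associatedPrimes (CoordRing k n) (CoordRing k n ⧸ I),
    ((I ^ m).map (algebraMap (CoordRing k n) (Localization.AtPrime Q.1))).comap
      (algebraMap (CoordRing k n) (Localization.AtPrime Q.1))

/-! ### Hilbert function and Hilbert polynomial -/

/-- `HF_J(d) = dim_k (S_d / J_d)`. -/
def hilbertFunction (J : Ideal (CoordRing k n)) (d : ℕ) : ℕ :=
  Module.finrank k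
    (MvPolynomial.homogeneousSubmodule (Fin (n + 1)) k d ⧸
      (J.restrictScalars k).submoduleOf (MvPolynomial.homogeneousSubmodule (Fin (n + 1)) k d))

/-- `p` takes the values of the Hilbert function of `J` in all large degrees. -/
def IsHilbertPolynomial (J : Ideal (CoordRing k n)) (p : Polynomial ℚ) : Prop :=
  ∀ᶠ d : ℕ in atTop, p.eval (d : ℚ) = hilbertFunction J d

theorem IsHilbertPolynomial.unique {J : Ideal (CoordRing k n)} {p q : Polynomial ℚ}
    (hp : IsHilbertPolynomial J p) (hq : IsHilbertPolynomial J q) : p = q := by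
  obtain ⟨N, hN⟩ := eventually_atTop.1 (hp.and hq)
  refine Polynomial.eq_of_infinite_eval_eq p q
    (Set.Infinite.mono (s := (fun d : ℕ => (d : ℚ)) '' Set.Ici N) ?_ ?_)
  · rintro _ ⟨d, hd, rfl⟩
    exact (hN d hd).1.trans (hN d hd).2.symm
  · exact (Set.Ici_infinite N).image Nat.cast_injective.injOn

open Classical in
/-- The Hilbert polynomial `HP_J`: the unique polynomial that agrees with the Hilbert function in
all large degrees (it exists for every homogeneous ideal). -/
def hilbertPolynomial (J : Ideal (CoordRing k n)) : Polynomial ℚ :=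
  if h : ∃ p, IsHilbertPolynomial J p then h.choose else 0

theorem IsHilbertPolynomial.hilbertPolynomial_eq {J : Ideal (CoordRing k n)} {p : Polynomial ℚ}
    (hp : IsHilbertPolynomial J p) : hilbertPolynomial J = p := by
  have h : ∃ p, IsHilbertPolynomial J p := ⟨p, hp⟩
  rw [hilbertPolynomial, dif_pos h]
  exact h.choose_spec.unique hp

/-! ### Castelnuovo–Mumford regularity -/

/-- The Koszul differential on `S ⊗ Λ(e_1, …, e_{n+1})`,
`e_{i_0} ∧ ⋯ ∧ e_{i_p} ↦ ∑_l (-1)^l x_{i_l} e_{i_0} ∧ ⋯ (omit e_{i_l}) ⋯ ∧ e_{i_p}`,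
where an element is written as the family `z` of its coefficients, `z s` being the coefficient
of `e_s`. -/
def koszulD (k : Type*) [Field k] (n : ℕ) :
    (Finset (Fin (n + 1)) → CoordRing k n) →ₗ[k] (Finset (Fin (n + 1)) → CoordRing k n) where
  toFun z s := ∑ i ∈ sᶜ, (-1) ^ (s.filter (· < i)).card * MvPolynomial.X i * z (insert i s)
  map_add' z w := by
    funext s
    simp only [Pi.add_apply, mul_add, Finset.sum_add_distrib]
  map_smul' c z := by
    funext s
    simp only [Pi.smul_apply, mul_smul_comm, Finset.smul_sum, RingHom.id_apply]

/-- The part of internal degree `q` of the `p`-th term `J ⊗ Λ^p(k^{n+1})` of the Koszul complex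
of `x_1, …, x_{n+1}` with coefficients in `J` (each `e_i` has degree one). -/
def koszulChains (J : Ideal (CoordRing k n)) (p q : ℕ) :
    Submodule k (Finset (Fin (n + 1)) → CoordRing k n) where
  carrier := {z | ∀ s, z s ∈ J ∧ (s.card ≠ p → z s = 0) ∧
    ∀ α ∈ (z s).support, α.degree + p = q}
  zero_mem' s := by simp
  add_mem' := by
    intro z w hz hw s
    refine ⟨J.add_mem (hz s).1 (hw s).1, fun h => ?_, fun α hα => ?_⟩
    · simp [(hz s).2.1 h, (hw s).2.1 h]
    · rcases Finset.mem_union.1 (MvPolynomial.support_add hα) with h | h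
      · exact (hz s).2.2 α h
      · exact (hw s).2.2 α h
  smul_mem' := by
    intro c z hz s
    refine ⟨?_, fun h => ?_, fun α hα => (hz s).2.2 α (MvPolynomial.support_smul hα)⟩
    · rw [Pi.smul_apply, MvPolynomial.smul_eq_C_mul]
      exact J.mul_mem_left _ (hz s).1
    · simp [(hz s).2.1 h]

/-- `Tor_p^S(J, k)_q`, computed by the Koszul complex: cycles modulo boundaries. -/
abbrev koszulTor (J : Ideal (CoordRing k n)) (p q : ℕ) : Type _ :=
  ↥(koszulChains J p q ⊓ LinearMap.ker (koszulD k n)) ⧸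
    ((koszulChains J (p + 1) q).map (koszulD k n)).submoduleOf
      (koszulChains J p q ⊓ LinearMap.ker (koszulD k n))

/-- The Castelnuovo–Mumford regularity `reg J = sup {q - p : Tor_p^S(J, k)_q ≠ 0}` of a homogeneous
ideal `J` (it is `⊥` for the zero ideal). -/
def regularity (J : Ideal (CoordRing k n)) : EReal :=
  ⨆ (p : ℕ) (q : ℕ) (_ : Nontrivial (koszulTor J p q)), (((q : ℝ) - (p : ℝ) : ℝ) : EReal)

/-- `I` has linearly bounded symbolic regularity: `reg I^(m) ≤ a m + b` for all large `m`. -/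
def IsLBSR (I : Ideal (CoordRing k n)) : Prop :=
  ∃ a b : ℝ, 0 < a ∧ 0 < b ∧
    ∀ᶠ m : ℕ in atTop, regularity (symbolicPower I m) ≤ ((a * m + b : ℝ) : EReal)

/-! ### Generic initial ideals -/

/-- The degree reverse lexicographic order with `x_1 > x_2 > ⋯ > x_{n+1}`: `x^α < x^β` if
`|α| < |β|`, or `|α| = |β|` and the last nonzero entry of `α - β` is positive. -/
def DegRevLexLT (α β : Fin (n + 1) →₀ ℕ) : Prop :=
  α.degree < β.degree ∨
    (α.degree = β.degree ∧ ∃ i, β i < α i ∧ ∀ j, i < j → α j = β j)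

/-- `x^α` is the initial monomial of `f`. -/
def IsInitialExponent (f : CoordRing k n) (α : Fin (n + 1) →₀ ℕ) : Prop :=
  α ∈ f.support ∧ ∀ β ∈ f.support, β ≠ α → DegRevLexLT β α

/-- The initial ideal of `J` with respect to the degree reverse lexicographic order. -/
def initialIdeal (J : Ideal (CoordRing k n)) : Ideal (CoordRing k n) :=
  Ideal.span {u | ∃ f ∈ J, ∃ α, IsInitialExponent f α ∧ u = MvPolynomial.monomial α 1}

/-- The linear change of coordinates `x_i ↦ ∑_j g_{ij} x_j`. -/
def coordChange (g : GL (Fin (n + 1)) k) : CoordRing k n →ₐ[k] CoordRing k n :=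
  MvPolynomial.aeval fun i => ∑ j, MvPolynomial.C (g.1 i j) * MvPolynomial.X j

/-- A property holds for a generic coordinate change if it holds on a nonempty Zariski-open subset
of `GL_{n+1}(k)`: equivalently, wherever some nonzero polynomial in the matrix entries does not
vanish. -/
def ForGenericGL (p : GL (Fin (n + 1)) k → Prop) : Prop :=
  ∃ P : MvPolynomial (Fin (n + 1) × Fin (n + 1)) k, P ≠ 0 ∧
    ∀ g : GL (Fin (n + 1)) k, MvPolynomial.eval (fun ij => g.1 ij.1 ij.2) P ≠ 0 → p g

/-- The initial ideal of `J` after the coordinate change `g`. -/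
def initialIdealAfter (J : Ideal (CoordRing k n)) (g : GL (Fin (n + 1)) k) :
    Ideal (CoordRing k n) :=
  initialIdeal (J.map (coordChange g))

/-- The generic initial ideal of `J`: the monomial ideal generated by the monomials that lie in the
initial ideal of `g J` for generic `g`. For a homogeneous ideal `J`, the initial ideal of `g J` is
the same for all generic `g`, and this is then the generic initial ideal, see
`genericInitialIdeal_eq`. -/
def genericInitialIdeal (J : Ideal (CoordRing k n)) : Ideal (CoordRing k n) :=
  Ideal.span {u | ∃ α, u = MvPolynomial.monomial α 1 ∧
    ForGenericGL fun g => MvPolynomial.monomial α 1 ∈ initialIdealAfter J g}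

/-- Over an infinite field, two generic properties have a common witness. -/
theorem ForGenericGL.exists_and [Infinite k] {p q : GL (Fin (n + 1)) k → Prop}
    (hp : ForGenericGL p) (hq : ForGenericGL q) : ∃ g, p g ∧ q g := by
  obtain ⟨P, hP, hp⟩ := hp
  obtain ⟨Q, hQ, hq⟩ := hq
  have hd : (Matrix.mvPolynomialX (Fin (n + 1)) (Fin (n + 1)) k).det ≠ 0 :=
    Matrix.det_mvPolynomialX_ne_zero _ _
  have hne := mul_ne_zero (mul_ne_zero hP hQ) hd
  obtain ⟨x, hx⟩ : ∃ x, MvPolynomial.eval x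
      (P * Q * (Matrix.mvPolynomialX (Fin (n + 1)) (Fin (n + 1)) k).det) ≠ 0 := by
    by_contra! h
    exact hne (MvPolynomial.funext fun x => by rw [h x, map_zero])
  rw [map_mul, map_mul, RingHom.map_det] at hx
  have hmat : (MvPolynomial.eval x).mapMatrix
      (Matrix.mvPolynomialX (Fin (n + 1)) (Fin (n + 1)) k) = Matrix.of fun i j => x (i, j) := by
    ext i j
    simp [Matrix.mvPolynomialX]
  rw [hmat] at hx
  have h3 := right_ne_zero_of_mul hx
  have h12 := left_ne_zero_of_mul hx
  refine ⟨Matrix.GeneralLinearGroup.mkOfDetNeZero _ h3, hp _ ?_, hq _ ?_⟩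
  · exact left_ne_zero_of_mul h12
  · exact right_ne_zero_of_mul h12

/-- If `in(g J) = K` for generic `g`, then `K` is the generic initial ideal of `J`. -/
theorem genericInitialIdeal_eq [Infinite k] {J K : Ideal (CoordRing k n)}
    (h : ForGenericGL fun g => initialIdealAfter J g = K) : genericInitialIdeal J = K := by
  apply le_antisymm
  · refine Ideal.span_le.2 ?_
    rintro _ ⟨α, rfl, hα⟩
    obtain ⟨g, hg, hg'⟩ := hα.exists_and h
    exact hg' ▸ hg
  · obtain ⟨g, -, hg⟩ := h.exists_and h
    conv_lhs => rw [← hg]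
    refine Ideal.span_le.2 ?_
    rintro _ ⟨f, hf, α, hα, rfl⟩
    refine Ideal.subset_span ⟨α, rfl, ?_⟩
    obtain ⟨P, hP, hPK⟩ := h
    refine ⟨P, hP, fun g' hg' => ?_⟩
    change MvPolynomial.monomial α 1 ∈ initialIdealAfter J g'
    have hK : initialIdealAfter J g' = K := hPK g' hg'
    rw [hK, ← hg]
    exact Ideal.subset_span ⟨f, hf, α, hα, rfl⟩

/-! ### The convex sets -/

/-- The set `L_m ⊆ ℝ^n`, the union of the orthants `α + ℝ_{≥0}^n` over the monomials `x^α` of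
`gin(I^(m))`, regarded as an ideal of `k[x_1, …, x_n]` by setting `x_{n+1} = 1`. (When no minimal
generator of `gin(I^(m))` involves `x_{n+1}`, this is the same as contracting the ideal to
`k[x_1, …, x_n]`.) -/
def limitSet (I : Ideal (CoordRing k n)) (m : ℕ) : Set (Fin n → ℝ) :=
  {x | ∃ α : Fin (n + 1) →₀ ℕ,
    MvPolynomial.monomial α 1 ∈ genericInitialIdeal (symbolicPower I m) ∧
      ∀ i : Fin n, (α i.castSucc : ℝ) ≤ x i}

/-- `Γ(I)`, the closure of `⋂_{m ≥ 1} (ℝ_{≥0}^n \ conv(L_m) / m)`. -/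
def Gamma (I : Ideal (CoordRing k n)) : Set (Fin n → ℝ) :=
  closure (⋂ m : {m : ℕ // 1 ≤ m},
    {x : Fin n → ℝ | ∀ i, 0 ≤ x i} \
      (fun x => (m.1 : ℝ)⁻¹ • x) '' convexHull ℝ (limitSet I m.1))

/-- `T_t`, the simplex of the points of `ℝ_{≥0}^n` whose coordinates have sum at most `t`. -/
def simplexT (n : ℕ) (t : ℝ) : Set (Fin n → ℝ) :=
  {x | (∀ i, 0 ≤ x i) ∧ ∑ i, x i ≤ t}

/-! ### Asymptotic Hilbert function and polynomial -/

/-- The sequence `m ↦ HF_{I^(m)}(m t) / m^n`. -/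
def aHFSeq (I : Ideal (CoordRing k n)) (t : ℕ) (m : ℕ) : ℝ :=
  (hilbertFunction (symbolicPower I m) (m * t) : ℝ) / (m : ℝ) ^ n

/-- The sequence `m ↦ HP_{I^(m)}(m t) / m^n`. -/
def aHPSeq (I : Ideal (CoordRing k n)) (t : ℝ) (m : ℕ) : ℝ :=
  Polynomial.aeval ((m : ℝ) * t) (hilbertPolynomial (symbolicPower I m)) / (m : ℝ) ^ n

/-- The asymptotic Hilbert function `aHF_I(t)` (meaningful where the limit exists). -/
def aHF (I : Ideal (CoordRing k n)) (t : ℕ) : ℝ := limUnder atTop (aHFSeq I t)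

/-- The asymptotic Hilbert polynomial `aHP_I(t)` (meaningful where the limit exists). -/
def aHP (I : Ideal (CoordRing k n)) (t : ℝ) : ℝ := limUnder atTop (aHPSeq I t)

end AsymptoticHilbert

end

/-! Put the m-th symbolic power in generic coordinates. Since `I` is homogeneous, so are its
symbolic powers (they are stable under scaling the variables), and HF of `I^(m)` in degree d counts
the monomials of degree d outside `gin(I^(m))` (`hilbertFunction_eq_card`). If no associated prime
of `I` contains all variables, the last variable is generically a nonzerodivisor modulo `I^(m)`.
Reverse lexicographic initial ideals inherit this, so membership in gin ignores the last exponent.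
The remaining case is that of the irrelevant ideal, where every monomial of degree at least m lies
in gin. Dropping the last exponent thus turns HF in degree mt into a count of lattice points with
coordinate sum at most mt outside a set `E m` in ℕ^n (`hilbertFunction_symbolicPower`).

The sets `E m` form a graded family, because initial monomials multiply and `I^(m) I^(l) ⊆ I^(m+l)`.
After division by m^n the count is the volume of a union of cubes of side 1/m. The union U of the
rescaled convex hulls is convex, so its boundary is null. A point of the positive orthant outside U
is never removed by the family, and an interior point of U is eventually removed, since real convex
combinations can be rounded up at bounded cost. Dominated convergence gives the volume of Γ ∩ T_t
(`IsGradedFamily.tendsto_ncard`).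

To pass to Hilbert polynomials, use that above the regularity the Koszul complex is exact in the
relevant internal degrees. Its Euler characteristic says that the (n+1)-st difference of HF
vanishes, so HF equals HP there and HP has degree at most n (`eval_hilbertPolynomial_eq`). With
regularity at most am+b, degree mt is beyond this bound for t > a+b and m ≥ 1, hence aHP = aHF for
such integers t. Lagrange interpolation at n+1 of them carries convergence to every real t
(`aHPSeq_eq_sum`). -/

noncomputable section

namespace AsymptoticHilbert

/-! ### Leading positions of a subspace -/

section Leads

variable {ι k : Type*} [Fintype ι] [LinearOrder ι] [Field k]

open Classical in
/-- The positions of the last nonzero entries of the vectors of a subspace of `ι → k`. -/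
def leads (V : Submodule k (ι → k)) : Finset ι :=
  Finset.univ.filter fun i => ∃ v ∈ V, v i ≠ 0 ∧ ∀ j, i < j → v j = 0

theorem mem_leads {V : Submodule k (ι → k)} {i : ι} :
    i ∈ leads V ↔ ∃ v ∈ V, v i ≠ 0 ∧ ∀ j, i < j → v j = 0 := by
  simp [leads]

theorem exists_lead {v : ι → k} (hv : v ≠ 0) : ∃ i, v i ≠ 0 ∧ ∀ j, i < j → v j = 0 := by
  classical
  obtain ⟨i₀, hi₀⟩ := Function.ne_iff.1 hv
  have hne : (Finset.univ.filter fun i => v i ≠ 0).Nonempty := ⟨i₀, by simpa using hi₀⟩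
  refine ⟨_, (Finset.mem_filter.1 (Finset.max'_mem _ hne)).2, fun j hj => ?_⟩
  by_contra h
  exact absurd (Finset.le_max' _ j (by simpa using h)) (not_le.2 hj)

/-- Restriction of the vectors of `V` to the leading positions is injective. -/
theorem eq_zero_of_leads {V : Submodule k (ι → k)} {v : ι → k} (hv : v ∈ V)
    (h : ∀ i ∈ leads V, v i = 0) : v = 0 := by
  by_contra hne
  obtain ⟨i, hi, hij⟩ := exists_lead hne
  exact hi (h i (mem_leads.2 ⟨v, hv, hi, hij⟩))

/-- Vectors with distinct leading positions are independent: in a relation, evaluate at the last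
index whose coefficient is nonzero. Conversely, restriction to the leading positions is injective,
which bounds the dimension. -/
theorem card_leads (V : Submodule k (ι → k)) : (leads V).card = Module.finrank k V := by
  classical
  choose w hw hwi hwj using fun i : leads V => mem_leads.1 i.2
  have hli : LinearIndependent k (fun i : leads V => (⟨w i, hw i⟩ : V)) := by
    rw [Fintype.linearIndependent_iff]
    intro c hc
    by_contra! hne
    obtain ⟨i, hi, hij⟩ := exists_lead (v := c) (Function.ne_iff.2 hne)
    have hs := congrArg (fun v : V => (v : ι → k) i.1) hc
    simp only [Submodule.coe_sum, Submodule.coe_smul, Finset.sum_apply, Pi.smul_apply,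
      smul_eq_mul, Submodule.coe_zero, Pi.zero_apply] at hs
    rw [Finset.sum_eq_single i] at hs
    · exact (mul_ne_zero hi (hwi i)) hs
    · intro j _ hji
      rcases lt_or_gt_of_ne hji with h | h
      · rw [hwj j i.1 h, mul_zero]
      · rw [hij j h, zero_mul]
    · simp
  apply le_antisymm
  · simpa using hli.fintype_card_le_finrank
  · let φ : V →ₗ[k] (leads V → k) :=
      (LinearMap.funLeft k k (fun i : leads V => i.1)).comp V.subtype
    have hφ : Function.Injective φ := by
      rw [← LinearMap.ker_eq_bot, LinearMap.ker_eq_bot']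
      intro v hv
      exact Subtype.ext (eq_zero_of_leads v.2 fun i hi => congrFun hv ⟨i, hi⟩)
    simpa using LinearMap.finrank_le_finrank_of_injective hφ

/-- The vectors of `V` that vanish at all positions `≥ b`. -/
def truncBelow (V : Submodule k (ι → k)) (b : ι) : Submodule k (ι → k) where
  carrier := {v | v ∈ V ∧ ∀ j, b ≤ j → v j = 0}
  zero_mem' := ⟨V.zero_mem, fun _ _ => rfl⟩
  add_mem' hv hw := ⟨V.add_mem hv.1 hw.1, fun j hj => by simp [hv.2 j hj, hw.2 j hj]⟩
  smul_mem' c v hv := ⟨V.smul_mem c hv.1, fun j hj => by simp [hv.2 j hj]⟩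

theorem leads_truncBelow (V : Submodule k (ι → k)) (b : ι) :
    leads (truncBelow V b) = (leads V).filter (· < b) := by
  ext i
  simp only [Finset.mem_filter, mem_leads]
  constructor
  · rintro ⟨v, hv, hi, hij⟩
    exact ⟨⟨v, hv.1, hi, hij⟩, lt_of_not_ge fun h => hi (hv.2 i h)⟩
  · rintro ⟨⟨v, hv, hi, hij⟩, hib⟩
    exact ⟨v, ⟨hv, fun j hj => hij j (hib.trans_le hj)⟩, hi, hij⟩

/-- If every assignment of values at the positions in `B` is realized in `V`, then above every
position `b` there are at least as many leading positions of `V` as elements of `B`. -/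
theorem card_filter_le_of_surjective (V : Submodule k (ι → k)) (B : Finset ι)
    (h : ∀ c : ι → k, ∃ v ∈ V, ∀ i ∈ B, v i = c i) (b : ι) :
    (B.filter (b ≤ ·)).card ≤ ((leads V).filter (b ≤ ·)).card := by
  classical
  have h1 : ((leads V).filter (· < b)).card + ((leads V).filter (b ≤ ·)).card
      = Module.finrank k V := by
    rw [← card_leads, ← Finset.card_filter_add_card_filter_not (s := leads V) (· < b)]
    simp only [not_lt]
  rw [← leads_truncBelow, card_leads] at h1
  let ψ : V →ₗ[k] (B.filter (b ≤ ·) → k) :=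
    (LinearMap.funLeft k k (fun i : B.filter (b ≤ ·) => i.1)).comp V.subtype
  have hψ : LinearMap.range ψ = ⊤ := by
    rw [LinearMap.range_eq_top]
    intro c
    obtain ⟨v, hv, hvc⟩ := h fun i => if hi : i ∈ B.filter (b ≤ ·) then c ⟨i, hi⟩ else 0
    refine ⟨⟨v, hv⟩, funext fun i => ?_⟩
    have := hvc i.1 (Finset.mem_filter.1 i.2).1
    rw [dif_pos i.2] at this
    exact this
  have h2 := LinearMap.finrank_range_add_finrank_ker ψ
  rw [hψ, finrank_top, Module.finrank_fintype_fun_eq_card, Fintype.card_coe] at h2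
  -- The rank of `ψ` is the tail count of `B`, while the tail count of the leads is the codimension
  -- of `truncBelow V b`. Since `truncBelow V b` is killed by `ψ`, the first is at most the second.
  have h3 : Module.finrank k (truncBelow V b) ≤ Module.finrank k (LinearMap.ker ψ) := by
    let θ : truncBelow V b →ₗ[k] LinearMap.ker ψ :=
      LinearMap.codRestrict _ (Submodule.inclusion fun v (hv : v ∈ truncBelow V b) => hv.1)
        fun v => funext fun i => v.2.2 i.1 (Finset.mem_filter.1 i.2).2
    refine LinearMap.finrank_le_finrank_of_injective (f := θ) fun v w hvw => ?_
    exact Subtype.ext (congrArg (fun x : LinearMap.ker ψ => (x.1.1 : ι → k)) hvw)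
  omega

/-- An element belongs to a set exactly where the tail count jumps. The open tail above b is the
closed tail at the successor of b, or empty, so closed tail counts determine everything. -/
theorem eq_of_card_filter_eq {B B' : Finset ι}
    (h : ∀ b, (B.filter (b ≤ ·)).card = (B'.filter (b ≤ ·)).card) : B = B' := by
  classical
  have key : ∀ C : Finset ι, ∀ b, b ∈ C ↔ ((C.filter (b ≤ ·)).card ≠ (C.filter (b < ·)).card) := by
    intro C b
    have hsub : C.filter (b < ·) ⊆ C.filter (b ≤ ·) :=
      Finset.monotone_filter_right _ fun _ _ h => le_of_lt h
    constructor
    · intro hb heq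
      have := Finset.eq_of_subset_of_card_le hsub heq.le
      have hb' : b ∈ C.filter (b < ·) := this ▸ (Finset.mem_filter.2 ⟨hb, le_rfl⟩)
      exact lt_irrefl _ (Finset.mem_filter.1 hb').2
    · intro hne
      by_contra hb
      refine hne (congrArg _ (Finset.filter_congr fun x hx => ?_))
      exact ⟨fun h => lt_of_le_of_ne h fun e => hb (e ▸ hx), le_of_lt⟩
  have hlt : ∀ b, (B.filter (b < ·)).card = (B'.filter (b < ·)).card := by
    intro b
    by_cases hb : (Finset.univ.filter (b < ·)).Nonempty
    · have hc : ∀ x, b < x ↔ Finset.min' _ hb ≤ x := fun x =>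
        ⟨fun h => Finset.min'_le _ _ (by simpa using h),
          fun h => lt_of_lt_of_le (Finset.mem_filter.1 (Finset.min'_mem _ hb)).2 h⟩
      rw [Finset.filter_congr fun x _ => hc x, Finset.filter_congr (s := B') fun x _ => hc x]
      exact h _
    · have hc : ∀ x, ¬ b < x := fun x hx => hb ⟨x, by simpa using hx⟩
      simp [hc]
  ext b
  rw [key B, key B', h, hlt]

end Leads

/-! ### The degree reverse lexicographic order -/

section RevLex

variable {n : ℕ}

theorem DegRevLexLT.irrefl (α : Fin (n + 1) →₀ ℕ) : ¬ DegRevLexLT α α := by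
  rintro (h | ⟨-, i, hi, -⟩)
  · exact lt_irrefl _ h
  · exact lt_irrefl _ hi

theorem DegRevLexLT.trans {α β γ : Fin (n + 1) →₀ ℕ} (h : DegRevLexLT α β)
    (h' : DegRevLexLT β γ) : DegRevLexLT α γ := by
  rcases h with h | ⟨h, i, hi, hij⟩ <;> rcases h' with h' | ⟨h', i', hi', hij'⟩
  · exact Or.inl (h.trans h')
  · exact Or.inl (h' ▸ h)
  · exact Or.inl (h ▸ h')
  · refine Or.inr ⟨h.trans h', ?_⟩
    rcases lt_trichotomy i i' with hii | rfl | hii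
    · exact ⟨i', (hij i' hii) ▸ hi', fun j hj => (hij j (hii.trans hj)).trans (hij' j hj)⟩
    · exact ⟨i, hi'.trans hi, fun j hj => (hij j hj).trans (hij' j hj)⟩
    · exact ⟨i, (hij' i hii) ▸ hi, fun j hj => (hij j hj).trans (hij' j (hii.trans hj))⟩

theorem DegRevLexLT.trichotomous (α β : Fin (n + 1) →₀ ℕ) :
    DegRevLexLT α β ∨ α = β ∨ DegRevLexLT β α := by
  rcases lt_trichotomy α.degree β.degree with h | h | h
  · exact Or.inl (Or.inl h)
  · by_cases hab : α = β
    · exact Or.inr (Or.inl hab)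
    have hne : (Finset.univ.filter fun i => α i ≠ β i).Nonempty := by
      obtain ⟨i, hi⟩ := DFunLike.ne_iff.1 hab
      exact ⟨i, by simpa using hi⟩
    have hmax : ∀ j, Finset.max' _ hne < j → α j = β j := by
      intro j hj
      by_contra hjn
      exact absurd (Finset.le_max' _ j (by simpa using hjn)) (not_le.2 hj)
    have hm := (Finset.mem_filter.1 (Finset.max'_mem _ hne)).2
    rcases lt_or_gt_of_ne hm with hlt | hlt
    · exact Or.inr (Or.inr (Or.inr ⟨h.symm, _, hlt, fun j hj => (hmax j hj).symm⟩))
    · exact Or.inl (Or.inr ⟨h, _, hlt, hmax⟩)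
  · exact Or.inr (Or.inr (Or.inl h))

theorem DegRevLexLT.add_left {α β : Fin (n + 1) →₀ ℕ} (h : DegRevLexLT α β)
    (γ : Fin (n + 1) →₀ ℕ) : DegRevLexLT (γ + α) (γ + β) := by
  rcases h with h | ⟨h, i, hi, hij⟩
  · left
    simpa [map_add] using h
  · right
    refine ⟨by simp [map_add, h], i, by simpa using hi, fun j hj => by simp [hij j hj]⟩

/-- This is the feature that singles out the reverse lexicographic order: if the last variable
divides the initial monomial of a form, it divides the whole form. -/
theorem DegRevLexLT.last_le {α β : Fin (n + 1) →₀ ℕ} (h : DegRevLexLT α β)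
    (hd : α.degree = β.degree) : β (Fin.last n) ≤ α (Fin.last n) := by
  rcases h with h | ⟨-, i, hi, hij⟩
  · exact absurd h (by omega)
  · rcases (Fin.le_last i).lt_or_eq with h | rfl
    · exact (hij _ h).ge
    · exact hi.le

/-- The exponents of degree `d`, in the reverse lexicographic order. -/
def DegExp (n d : ℕ) : Type := {α : Fin (n + 1) →₀ ℕ // α.degree = d}

instance (d : ℕ) : Finite (DegExp n d) := by
  refine Finite.of_injective
    (fun α : DegExp n d => fun i => (⟨α.1 i, Nat.lt_succ_of_le
      ((Finsupp.le_degree i α.1).trans α.2.le)⟩ : Fin (d + 1))) fun α β h => ?_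
  refine Subtype.ext (Finsupp.ext fun i => ?_)
  have := congrFun h i
  simpa using this

instance (d : ℕ) : Fintype (DegExp n d) := Fintype.ofFinite _

instance (d : ℕ) : IsStrictTotalOrder (DegExp n d) (fun α β => DegRevLexLT α.1 β.1) where
  irrefl α := DegRevLexLT.irrefl α.1
  trans _ _ _ h h' := h.trans h'
  trichotomous α β h h' := by
    rcases DegRevLexLT.trichotomous α.1 β.1 with h1 | h1 | h1
    · exact absurd h1 h
    · exact Subtype.ext h1
    · exact absurd h1 h'

open Classical in
instance (d : ℕ) : LinearOrder (DegExp n d) :=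
  linearOrderOfSTO (fun α β : DegExp n d => DegRevLexLT α.1 β.1)

theorem DegExp.lt_iff {d : ℕ} {α β : DegExp n d} : α < β ↔ DegRevLexLT α.1 β.1 := Iff.rfl

end RevLex

/-! ### Initial ideals and dimensions -/

section Initial

open MvPolynomial

variable {k : Type*} [Field k] {n : ℕ}

theorem IsInitialExponent.monomial_mul {f : CoordRing k n} {α : Fin (n + 1) →₀ ℕ}
    (h : IsInitialExponent f α) (γ : Fin (n + 1) →₀ ℕ) :
    IsInitialExponent (monomial γ 1 * f) (γ + α) := by
  have hsupp : ∀ β, β ∈ (monomial γ (1 : k) * f).support → ∃ δ ∈ f.support, β = γ + δ := by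
    intro β hβ
    rw [mem_support_iff, coeff_monomial_mul'] at hβ
    split_ifs at hβ with hle
    · exact ⟨β - γ, by simpa using hβ, (add_tsub_cancel_of_le hle).symm⟩
    · exact absurd rfl hβ
  refine ⟨?_, fun β hβ hne => ?_⟩
  · rw [mem_support_iff, coeff_monomial_mul, one_mul]
    exact mem_support_iff.1 h.1
  · obtain ⟨δ, hδ, rfl⟩ := hsupp β hβ
    exact (h.2 δ hδ fun e => hne (by rw [e])).add_left γ

theorem IsInitialExponent.mul {f g : CoordRing k n} {α β : Fin (n + 1) →₀ ℕ}
    (hf : IsInitialExponent f α) (hg : IsInitialExponent g β) :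
    IsInitialExponent (f * g) (α + β) := by
  classical
  have hlt : ∀ γ ∈ f.support, ∀ δ ∈ g.support, (γ, δ) ≠ (α, β) →
      DegRevLexLT (γ + δ) (α + β) := by
    intro γ hγ δ hδ hne
    by_cases h1 : γ = α
    · subst h1
      exact (hg.2 δ hδ fun e => hne (by rw [e])).add_left _
    · have h2 := (hf.2 γ hγ h1).add_left δ
      rw [add_comm δ, add_comm δ] at h2
      by_cases h3 : δ = β
      · exact h3 ▸ h2
      · exact h2.trans ((hg.2 δ hδ h3).add_left α)
  refine ⟨?_, fun γ hγ hne => ?_⟩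
  · rw [mem_support_iff, coeff_mul, Finset.sum_eq_single (α, β)]
    · exact mul_ne_zero (mem_support_iff.1 hf.1) (mem_support_iff.1 hg.1)
    · rintro ⟨γ, δ⟩ hγδ hne
      rw [Finset.HasAntidiagonal.mem_antidiagonal] at hγδ
      by_contra hc
      have := hlt γ (mem_support_iff.2 (left_ne_zero_of_mul hc)) δ
        (mem_support_iff.2 (right_ne_zero_of_mul hc)) hne
      rw [show γ + δ = α + β from hγδ] at this
      exact DegRevLexLT.irrefl _ this
    · intro h
      simp at h
  · obtain ⟨a, ha, b, hb, rfl⟩ := Finset.mem_add.1 (support_mul f g hγ)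
    exact hlt a ha b hb fun e => hne (by rw [(Prod.mk.inj e).1, (Prod.mk.inj e).2])

/-- A monomial in an ideal spanned by monomials is a multiple of a generator, and multiplying the
witness by the quotient monomial shifts its initial exponent accordingly. -/
theorem monomial_mem_initialIdeal {J : Ideal (CoordRing k n)} {α : Fin (n + 1) →₀ ℕ} :
    monomial α 1 ∈ initialIdeal J ↔ ∃ f ∈ J, IsInitialExponent f α := by
  constructor
  · intro h
    have hset : {u | ∃ f ∈ J, ∃ α, IsInitialExponent f α ∧ u = monomial α (1 : k)} =
        (fun s => monomial s (1 : k)) '' {α | ∃ f ∈ J, IsInitialExponent f α} := by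
      ext u
      constructor
      · rintro ⟨f, hf, α, hα, rfl⟩
        exact ⟨α, ⟨f, hf, hα⟩, rfl⟩
      · rintro ⟨α, ⟨f, hf, hα⟩, rfl⟩
        exact ⟨f, hf, α, hα, rfl⟩
    rw [initialIdeal, hset, mem_ideal_span_monomial_image] at h
    obtain ⟨β, ⟨f, hf, hβ⟩, hle⟩ := h α (by simp [mem_support_iff])
    refine ⟨monomial (α - β) 1 * f, J.mul_mem_left _ hf, ?_⟩
    have := hβ.monomial_mul (α - β)
    rwa [tsub_add_cancel_of_le hle] at this
  · rintro ⟨f, hf, hα⟩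
    exact Ideal.subset_span ⟨f, hf, α, hα, rfl⟩

/-- `J` contains the homogeneous components of its elements. -/
def ContainsComponents (J : Ideal (CoordRing k n)) : Prop :=
  ∀ f ∈ J, ∀ d, homogeneousComponent d f ∈ J

theorem containsComponents_of_isHomogeneous {J : Ideal (CoordRing k n)}
    (h : J.IsHomogeneous (homogeneousSubmodule (Fin (n + 1)) k)) : ContainsComponents J := by
  intro f hf d
  have := h d hf
  rw [← decomposition.decompose'_apply]
  exact this

theorem ContainsComponents.exists_isHomogeneous {J : Ideal (CoordRing k n)}
    (hJ : ContainsComponents J) {f : CoordRing k n} (hf : f ∈ J) {α : Fin (n + 1) →₀ ℕ}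
    (h : IsInitialExponent f α) :
    ∃ f ∈ J, f.IsHomogeneous α.degree ∧ IsInitialExponent f α := by
  refine ⟨_, hJ f hf α.degree, homogeneousComponent_isHomogeneous _ _, ?_, fun β hβ hne => ?_⟩
  · rw [mem_support_iff, coeff_homogeneousComponent, if_pos rfl]
    exact mem_support_iff.1 h.1
  · rw [mem_support_iff, coeff_homogeneousComponent] at hβ
    refine h.2 β (mem_support_iff.2 fun h0 => hβ ?_) hne
    rw [h0, ite_self]

/-- If the last variable is a nonzerodivisor modulo the homogeneous ideal `J`, then it is a
nonzerodivisor modulo the initial ideal. -/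
theorem monomial_mem_initialIdeal_of_add_single {J : Ideal (CoordRing k n)}
    (hJ : ContainsComponents J) (hsat : ∀ f, X (Fin.last n) * f ∈ J → f ∈ J)
    {α : Fin (n + 1) →₀ ℕ}
    (h : monomial (Finsupp.single (Fin.last n) 1 + α) 1 ∈ initialIdeal J) :
    monomial α 1 ∈ initialIdeal J := by
  rw [monomial_mem_initialIdeal] at h ⊢
  obtain ⟨f₀, hf₀, hα₀⟩ := h
  obtain ⟨f, hf, hhom, hα⟩ := hJ.exists_isHomogeneous hf₀ hα₀
  -- Every other monomial of the form `f` is smaller than the initial one, so by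
  -- `DegRevLexLT.last_le` its last exponent is at least as large, hence positive.
  have hdvd : X (Fin.last n) ∣ f := by
    rw [X_dvd_iff_modMonomial_eq_zero]
    ext β
    rw [coeff_zero]
    by_cases hβ : Finsupp.single (Fin.last n) 1 ≤ β
    · exact coeff_modMonomial_of_le _ hβ
    rw [coeff_modMonomial_of_not_le _ hβ]
    by_contra hne
    apply hβ
    rw [Finsupp.single_le_iff]
    by_cases heq : β = Finsupp.single (Fin.last n) 1 + α
    · rw [heq]; simp
    · have h1 := (hα.2 β (mem_support_iff.2 hne) heq).last_le ?_
      · simp at h1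
        omega
      · by_contra hd
        exact hne (hhom.coeff_eq_zero hd)
  obtain ⟨g, rfl⟩ := hdvd
  refine ⟨g, hsat g hf, ?_, fun β hβ hne => ?_⟩
  · have := mem_support_iff.1 hα.1
    rw [coeff_X_mul] at this
    exact mem_support_iff.2 this
  · have h1 := hα.2 (Finsupp.single (Fin.last n) 1 + β)
      (by rw [mem_support_iff, coeff_X_mul]; exact mem_support_iff.1 hβ) (by simpa using hne)
    rcases h1 with h1 | ⟨h1, i, hi, hij⟩
    · left
      simpa [map_add] using h1
    · right
      refine ⟨by simpa [map_add] using h1, i, by simpa using hi, fun j hj => ?_⟩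
      simpa using hij j hj

/-- The part of degree `d` of the ideal `J`. -/
def degPart (J : Ideal (CoordRing k n)) (d : ℕ) : Submodule k (CoordRing k n) :=
  J.restrictScalars k ⊓ homogeneousSubmodule (Fin (n + 1)) k d

theorem mem_degPart {J : Ideal (CoordRing k n)} {d : ℕ} {f : CoordRing k n} :
    f ∈ degPart J d ↔ f ∈ J ∧ f.IsHomogeneous d := Iff.rfl

/-- The coefficients of a polynomial in degree `d`. -/
def degCoeffs (k : Type*) [Field k] (n d : ℕ) : CoordRing k n →ₗ[k] (DegExp n d → k) where
  toFun f α := coeff α.1 f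
  map_add' f g := by ext; simp
  map_smul' c f := by ext; simp

theorem degCoeffs_apply {d : ℕ} (f : CoordRing k n) (α : DegExp n d) :
    degCoeffs k n d f α = coeff α.1 f := rfl

theorem degCoeffs_injOn {d : ℕ} {f : CoordRing k n} (hf : f.IsHomogeneous d)
    (h : degCoeffs k n d f = 0) : f = 0 := by
  ext α
  by_cases hα : α.degree = d
  · exact congrFun h ⟨α, hα⟩
  · rw [hf.coeff_eq_zero hα, coeff_zero]

theorem finrank_map_degCoeffs {d : ℕ} (V : Submodule k (CoordRing k n))
    (hV : V ≤ homogeneousSubmodule (Fin (n + 1)) k d) :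
    Module.finrank k (V.map (degCoeffs k n d)) = Module.finrank k V := by
  have hinj : Function.Injective ((degCoeffs k n d).domRestrict V) := by
    rw [← LinearMap.ker_eq_bot, LinearMap.ker_eq_bot']
    intro v hv
    exact Subtype.ext (degCoeffs_injOn (hV v.2) hv)
  rw [← LinearMap.range_domRestrict]
  exact LinearMap.finrank_range_of_inj hinj

theorem map_degCoeffs_homogeneousSubmodule (d : ℕ) :
    (homogeneousSubmodule (Fin (n + 1)) k d).map (degCoeffs k n d) = ⊤ := by
  rw [eq_top_iff]
  intro c _
  classical
  refine ⟨∑ α : DegExp n d, monomial α.1 (c α), ?_, ?_⟩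
  · exact Submodule.sum_mem _ fun α _ => isHomogeneous_monomial _ α.2
  · ext β
    rw [degCoeffs_apply, coeff_sum, Finset.sum_eq_single β]
    · simp
    · intro α _ hne
      rw [coeff_monomial, if_neg fun h => hne (Subtype.ext h)]
    · simp

theorem finrank_homogeneousSubmodule (d : ℕ) :
    Module.finrank k (homogeneousSubmodule (Fin (n + 1)) k d) = Fintype.card (DegExp n d) := by
  rw [← finrank_map_degCoeffs _ le_rfl, map_degCoeffs_homogeneousSubmodule, finrank_top,
    Module.finrank_fintype_fun_eq_card]

instance finite_homogeneousSubmodule (d : ℕ) :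
    Module.Finite k (homogeneousSubmodule (Fin (n + 1)) k d) := by
  refine Module.Finite.of_injective
    ((degCoeffs k n d).domRestrict (homogeneousSubmodule (Fin (n + 1)) k d)) ?_
  rw [← LinearMap.ker_eq_bot, LinearMap.ker_eq_bot']
  intro v hv
  exact Subtype.ext (degCoeffs_injOn v.2 hv)

theorem hilbertFunction_add_finrank (J : Ideal (CoordRing k n)) (d : ℕ) :
    hilbertFunction J d + Module.finrank k (degPart J d) = Fintype.card (DegExp n d) := by
  rw [← finrank_homogeneousSubmodule (k := k), hilbertFunction,
    ← Submodule.finrank_quotient_add_finrank ((J.restrictScalars k).submoduleOf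
      (homogeneousSubmodule (Fin (n + 1)) k d))]
  congr 1
  rw [Submodule.submoduleOf, ← Submodule.finrank_map_subtype_eq, Submodule.map_comap_subtype,
    inf_comm]
  rfl

/-- Links linear algebra to initial ideals: the order on `DegExp n d` makes the last nonzero
coefficient the initial one, and for homogeneous `J` a witness may be replaced by its component in
degree d. -/
theorem mem_leads_degPart {J : Ideal (CoordRing k n)} (hJ : ContainsComponents J) {d : ℕ}
    {α : DegExp n d} :
    α ∈ leads ((degPart J d).map (degCoeffs k n d)) ↔ monomial α.1 1 ∈ initialIdeal J := by
  rw [mem_leads, monomial_mem_initialIdeal]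
  constructor
  · rintro ⟨_, ⟨f, hf, rfl⟩, hα, hlt⟩
    refine ⟨f, hf.1, mem_support_iff.2 hα, fun β hβ hne => ?_⟩
    have hdeg : β.degree = d := by
      by_contra hd
      exact mem_support_iff.1 hβ ((mem_degPart.1 hf).2.coeff_eq_zero hd)
    rcases DegRevLexLT.trichotomous β α.1 with h | h | h
    · exact h
    · exact absurd h hne
    · exact absurd (hlt ⟨β, hdeg⟩ (DegExp.lt_iff.2 h)) (mem_support_iff.1 hβ)
  · rintro ⟨f₀, hf₀, hα₀⟩
    obtain ⟨f, hf, hhom, hα⟩ := hJ.exists_isHomogeneous hf₀ hα₀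
    rw [α.2] at hhom
    refine ⟨_, ⟨f, mem_degPart.2 ⟨hf, hhom⟩, rfl⟩, mem_support_iff.1 hα.1, fun β hβ => ?_⟩
    by_contra hne
    have h1 := hα.2 β.1 (mem_support_iff.2 hne) fun e => hβ.ne (Subtype.ext e.symm)
    exact DegRevLexLT.irrefl _ (h1.trans (DegExp.lt_iff.1 hβ))

end Initial

/-! ### Coordinate changes -/

section Coord

open MvPolynomial

variable {k : Type*} [Field k] {n : ℕ}

theorem coordChange_X (g : GL (Fin (n + 1)) k) (i : Fin (n + 1)) :
    coordChange g (X i) = ∑ j, C (g.1 i j) * X j := by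
  simp [coordChange]

/-- Substitution reverses the order of the matrices: the outer change acts on the variables produced
by the inner one. -/
theorem coordChange_coordChange (g h : GL (Fin (n + 1)) k) (f : CoordRing k n) :
    coordChange g (coordChange h f) = coordChange (h * g) f := by
  have : (coordChange g).comp (coordChange h) = coordChange (h * g) := by
    refine MvPolynomial.algHom_ext fun i => ?_
    rw [AlgHom.comp_apply, coordChange_X, coordChange_X, map_sum]
    simp only [map_mul, algHom_C, coordChange_X, Finset.mul_sum, Units.val_mul, Matrix.mul_apply,
      map_sum, Finset.sum_mul, algebraMap_eq]
    rw [Finset.sum_comm]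
    simp only [mul_assoc]
  exact DFunLike.congr_fun this f

theorem coordChange_one (f : CoordRing k n) : coordChange (1 : GL (Fin (n + 1)) k) f = f := by
  have : coordChange (1 : GL (Fin (n + 1)) k) = AlgHom.id k (CoordRing k n) := by
    refine MvPolynomial.algHom_ext fun i => ?_
    rw [coordChange_X, Finset.sum_eq_single i]
    · simp
    · intro j _ hj
      simp [Matrix.one_apply_ne hj.symm]
    · simp
  exact DFunLike.congr_fun this f

theorem coordChange_inv_coordChange (g : GL (Fin (n + 1)) k) (f : CoordRing k n) :
    coordChange g⁻¹ (coordChange g f) = f := by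
  rw [coordChange_coordChange, mul_inv_cancel, coordChange_one]

theorem coordChange_coordChange_inv (g : GL (Fin (n + 1)) k) (f : CoordRing k n) :
    coordChange g (coordChange g⁻¹ f) = f := by
  rw [coordChange_coordChange, inv_mul_cancel, coordChange_one]

theorem mem_map_coordChange {J : Ideal (CoordRing k n)} {g : GL (Fin (n + 1)) k}
    {f : CoordRing k n} : f ∈ J.map (coordChange g) ↔ coordChange g⁻¹ f ∈ J := by
  rw [Ideal.mem_map_iff_of_surjective (coordChange g)
    fun f => ⟨_, coordChange_coordChange_inv g f⟩]
  constructor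
  · rintro ⟨h, hh, rfl⟩
    rwa [coordChange_inv_coordChange]
  · exact fun h => ⟨_, h, coordChange_coordChange_inv g f⟩

theorem coordChange_isHomogeneous (g : GL (Fin (n + 1)) k) {f : CoordRing k n} {d : ℕ}
    (hf : f.IsHomogeneous d) : (coordChange g f).IsHomogeneous d := by
  have := hf.aeval (fun i => ∑ j, C (g.1 i j) * X j) (n := 1) fun i =>
    IsHomogeneous.sum _ _ _ fun j _ => (isHomogeneous_C_mul_X _ _)
  rwa [one_mul] at this

theorem homogeneousComponent_coordChange (g : GL (Fin (n + 1)) k) (f : CoordRing k n) (d : ℕ) :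
    homogeneousComponent d (coordChange g f) = coordChange g (homogeneousComponent d f) := by
  conv_lhs => rw [← sum_homogeneousComponent f, map_sum, map_sum]
  have h : ∀ i, homogeneousComponent d (coordChange g (homogeneousComponent i f)) =
      if i = d then coordChange g (homogeneousComponent d f) else 0 := by
    intro i
    rw [homogeneousComponent_of_mem
      (coordChange_isHomogeneous g (homogeneousComponent_isHomogeneous i f))]
    by_cases hid : d = i
    · rw [if_pos hid, if_pos hid.symm, hid]
    · rw [if_neg hid, if_neg (Ne.symm hid)]
  simp only [h]
  rw [Finset.sum_ite_eq']
  split_ifs with hd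
  · rfl
  · rw [homogeneousComponent_eq_zero, map_zero]
    simpa using hd

theorem ContainsComponents.map_coordChange {J : Ideal (CoordRing k n)} (hJ : ContainsComponents J)
    (g : GL (Fin (n + 1)) k) : ContainsComponents (J.map (coordChange g)) := by
  intro f hf d
  rw [mem_map_coordChange] at hf ⊢
  rw [← homogeneousComponent_coordChange]
  exact hJ _ hf d

theorem degPart_map_coordChange (J : Ideal (CoordRing k n)) (g : GL (Fin (n + 1)) k) (d : ℕ) :
    degPart (J.map (coordChange g)) d = (degPart J d).map (coordChange g).toLinearMap := by
  ext f
  rw [mem_degPart, mem_map_coordChange, Submodule.mem_map]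
  constructor
  · rintro ⟨h1, h2⟩
    exact ⟨_, mem_degPart.2 ⟨h1, coordChange_isHomogeneous _ h2⟩, coordChange_coordChange_inv g f⟩
  · rintro ⟨h, hh, rfl⟩
    rw [AlgHom.toLinearMap_apply, coordChange_inv_coordChange]
    exact ⟨hh.1, coordChange_isHomogeneous g hh.2⟩

theorem finrank_degPart_map_coordChange (J : Ideal (CoordRing k n)) (g : GL (Fin (n + 1)) k)
    (d : ℕ) : Module.finrank k (degPart (J.map (coordChange g)) d) =
      Module.finrank k (degPart J d) := by
  rw [degPart_map_coordChange]
  refine (LinearEquiv.finrank_eq (Submodule.equivMapOfInjective _ (fun f h hfh => ?_) _)).symm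
  simpa [coordChange_inv_coordChange] using congrArg (coordChange g⁻¹) hfh

/-- The coefficients of `g f` are polynomial functions of the entries of `g`. -/
theorem exists_eval_eq_coeff_coordChange (f : CoordRing k n) (α : Fin (n + 1) →₀ ℕ) :
    ∃ p : MvPolynomial (Fin (n + 1) × Fin (n + 1)) k, ∀ g : GL (Fin (n + 1)) k,
      eval (fun ij => g.1 ij.1 ij.2) p = coeff α (coordChange g f) := by
  let R := MvPolynomial (Fin (n + 1) × Fin (n + 1)) k
  let F : MvPolynomial (Fin (n + 1)) R :=
    eval₂Hom ((C : R →+* MvPolynomial (Fin (n + 1)) R).comp C)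
      (fun i => ∑ j, C (X (i, j)) * X j) f
  refine ⟨coeff α F, fun g => ?_⟩
  rw [← coeff_map]
  congr 1
  change ((MvPolynomial.map _).comp (eval₂Hom _ _)) f = (coordChange g).toRingHom f
  congr 1
  refine ringHom_ext (fun r => ?_) fun i => ?_
  · simp [algebraMap_eq]
    exact eval_C r
  · simp [coordChange_X]

end Coord

/-! ### Generic initial ideals -/

section Generic

open MvPolynomial

variable {k : Type*} [Field k] {n : ℕ}

theorem ForGenericGL.mono {p q : GL (Fin (n + 1)) k → Prop} (hp : ForGenericGL p)
    (h : ∀ g, p g → q g) : ForGenericGL q := by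
  obtain ⟨P, hP, hp⟩ := hp
  exact ⟨P, hP, fun g hg => h g (hp g hg)⟩

theorem ForGenericGL.and {p q : GL (Fin (n + 1)) k → Prop} (hp : ForGenericGL p)
    (hq : ForGenericGL q) : ForGenericGL fun g => p g ∧ q g := by
  obtain ⟨P, hP, hp⟩ := hp
  obtain ⟨Q, hQ, hq⟩ := hq
  refine ⟨P * Q, mul_ne_zero hP hQ, fun g hg => ?_⟩
  rw [map_mul] at hg
  exact ⟨hp g (left_ne_zero_of_mul hg), hq g (right_ne_zero_of_mul hg)⟩

theorem ForGenericGL.of_forall {p : GL (Fin (n + 1)) k → Prop} (h : ∀ g, p g) :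
    ForGenericGL p :=
  ⟨1, one_ne_zero, fun g _ => h g⟩

theorem ForGenericGL.forall_mem_finset {ι : Type*} (s : Finset ι)
    {p : ι → GL (Fin (n + 1)) k → Prop} (h : ∀ i ∈ s, ForGenericGL (p i)) :
    ForGenericGL fun g => ∀ i ∈ s, p i g := by
  classical
  induction s using Finset.induction_on with
  | empty => exact .of_forall (by simp)
  | insert a s _ ih =>
    refine ((h a (Finset.mem_insert_self a s)).and
      (ih fun i hi => h i (Finset.mem_insert_of_mem hi))).mono fun g hg i hi => ?_
    rcases Finset.mem_insert.1 hi with rfl | hi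
    · exact hg.1
    · exact hg.2 i hi

/-- The initial monomials of `g J` in degree `d` do not depend on the generic `g`. -/
theorem exists_generic_leads (J : Ideal (CoordRing k n)) (d : ℕ) :
    ∃ B : Finset (DegExp n d), B.card = Module.finrank k (degPart J d) ∧
      ForGenericGL fun g =>
        leads ((degPart (J.map (coordChange g)) d).map (degCoeffs k n d)) = B := by
  classical
  let V : GL (Fin (n + 1)) k → Submodule k (DegExp n d → k) := fun g =>
    (degPart (J.map (coordChange g)) d).map (degCoeffs k n d)
  have hV : ∀ g, (leads (V g)).card = Module.finrank k (degPart J d) := fun g => by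
    rw [card_leads, ← finrank_degPart_map_coordChange J g]
    exact finrank_map_degCoeffs _ inf_le_right
  -- The sum of all tail counts measures how high the leading monomials lie. There are finitely many
  -- lead sets, so some `g₀` maximizes it; generic `g` will do at least as well in every tail, hence
  -- exactly as well.
  obtain ⟨_, ⟨g₀, rfl⟩, hmax⟩ := Set.exists_max_image (Set.range fun g => leads (V g))
    (fun B => ∑ b, (B.filter (b ≤ ·)).card) (Set.toFinite _) ⟨_, ⟨1, rfl⟩⟩
  set B := leads (V g₀) with hB
  refine ⟨B, hV g₀, ?_⟩
  -- A reduced basis at `g₀`: restriction to the leads is an injection between spaces of equal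
  -- dimension, so coefficients at the positions in `B` can be prescribed.
  have hex : ∀ β : B, ∃ f ∈ degPart J d, ∀ γ : B,
      coeff γ.1.1 (coordChange g₀ f) = if β = γ then 1 else 0 := by
    intro β
    let φ : V g₀ →ₗ[k] (B → k) :=
      (LinearMap.funLeft k k (fun i : B => i.1)).comp (V g₀).subtype
    have hφ : Function.Injective φ := by
      rw [← LinearMap.ker_eq_bot, LinearMap.ker_eq_bot']
      intro v hv
      exact Subtype.ext (eq_zero_of_leads v.2 fun i hi => congrFun hv ⟨i, hi⟩)
    have hφs : Function.Surjective φ := by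
      refine (LinearMap.injective_iff_surjective_of_finrank_eq_finrank ?_).1 hφ
      rw [← card_leads, Module.finrank_fintype_fun_eq_card, Fintype.card_coe]
    obtain ⟨⟨v, hv⟩, hvφ⟩ := hφs fun γ => if β = γ then 1 else 0
    obtain ⟨w, hw, rfl⟩ := hv
    rw [degPart_map_coordChange] at hw
    obtain ⟨f, hf, rfl⟩ := hw
    exact ⟨f, hf, fun γ => congrFun hvφ γ⟩
  choose f hf hfγ using hex
  choose p hp using fun β γ : B => exists_eval_eq_coeff_coordChange (f β) γ.1.1
  have heval : ∀ g : GL (Fin (n + 1)) k, eval (fun ij => g.1 ij.1 ij.2) (Matrix.of p).det =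
      (Matrix.of fun β γ : B => coeff γ.1.1 (coordChange g (f β))).det := by
    intro g
    rw [RingHom.map_det]
    congr 1
    ext β γ
    simp [hp]
  -- The coefficient minor at the positions in `B` is polynomial in `g` and equals 1 at `g₀`. Where
  -- it is nonzero, inverting the matrix realizes any values on `B`.
  refine ⟨(Matrix.of p).det, fun h0 => ?_, fun g hg => ?_⟩
  · have h1 := heval g₀
    have h2 : (Matrix.of fun β γ : B => coeff γ.1.1 (coordChange g₀ (f β))) = 1 := by
      ext β γ
      simp [hfγ, Matrix.one_apply]
    rw [h0, map_zero, h2, Matrix.det_one] at h1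
    exact zero_ne_one h1
  · rw [heval] at hg
    set A := Matrix.of fun β γ : B => coeff γ.1.1 (coordChange g (f β)) with hA
    have hle := card_filter_le_of_surjective (V g) B fun c => by
      let a := Matrix.vecMul (fun β : B => c β.1) A⁻¹
      have ha : Matrix.vecMul a A = fun β : B => c β.1 := by
        rw [Matrix.vecMul_vecMul, Matrix.nonsing_inv_mul _ (isUnit_iff_ne_zero.2 hg),
          Matrix.vecMul_one]
      refine ⟨_, ⟨∑ β, a β • coordChange g (f β), ?_, rfl⟩, fun i hi => ?_⟩
      · refine Submodule.sum_mem _ fun β _ => Submodule.smul_mem _ _ ?_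
        rw [degPart_map_coordChange]
        exact ⟨_, hf β, rfl⟩
      · have := congrFun ha ⟨i, hi⟩
        rw [← this, degCoeffs_apply, coeff_sum, Matrix.vecMul, dotProduct]
        simp [hA]
    have hge := hmax _ ⟨g, rfl⟩
    have heq := (Finset.sum_eq_sum_iff_of_le fun b _ => hle b).1
      (le_antisymm (Finset.sum_le_sum fun b _ => hle b) hge)
    exact (eq_of_card_filter_eq fun b => heq b (Finset.mem_univ b)).symm

theorem monomial_mem_of_le {K : Ideal (CoordRing k n)} {α β : Fin (n + 1) →₀ ℕ}
    (hle : α ≤ β) (h : monomial α 1 ∈ K) : monomial β (1 : k) ∈ K := by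
  have := K.mul_mem_left (monomial (β - α) 1) h
  rwa [monomial_mul, one_mul, tsub_add_cancel_of_le hle] at this

/-- Generic membership passes to monomial multiples, so taking the span in the definition adds no
new monomials. -/
theorem monomial_mem_genericInitialIdeal {J : Ideal (CoordRing k n)} {α : Fin (n + 1) →₀ ℕ} :
    monomial α 1 ∈ genericInitialIdeal J ↔
      ForGenericGL fun g => monomial α 1 ∈ initialIdealAfter J g := by
  constructor
  · intro h
    have hset : {u | ∃ α, u = monomial α (1 : k) ∧
        ForGenericGL fun g => monomial α 1 ∈ initialIdealAfter J g} =
        (fun s => monomial s (1 : k)) ''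
          {α | ForGenericGL fun g => monomial α 1 ∈ initialIdealAfter J g} := by
      ext u
      constructor
      · rintro ⟨α, rfl, hα⟩
        exact ⟨α, hα, rfl⟩
      · rintro ⟨α, hα, rfl⟩
        exact ⟨α, rfl, hα⟩
    rw [genericInitialIdeal, hset, mem_ideal_span_monomial_image] at h
    obtain ⟨β, hβ, hle⟩ := h α (by simp [mem_support_iff])
    exact ForGenericGL.mono hβ fun g hg => monomial_mem_of_le hle hg
  · exact fun h => Ideal.subset_span ⟨α, rfl, h⟩

/-- Both memberships hold wherever the product of the two genericity polynomials is nonzero, and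
there initial exponents add. This makes the generic initial ideals of symbolic powers a graded
family. -/
theorem monomial_mem_genericInitialIdeal_mul {J K L : Ideal (CoordRing k n)} (hL : J * K ≤ L)
    {α β : Fin (n + 1) →₀ ℕ} (hα : monomial α 1 ∈ genericInitialIdeal J)
    (hβ : monomial β 1 ∈ genericInitialIdeal K) :
    monomial (α + β) 1 ∈ genericInitialIdeal L := by
  rw [monomial_mem_genericInitialIdeal] at *
  refine (hα.and hβ).mono fun g hg => ?_
  obtain ⟨f, hf, hfα⟩ := monomial_mem_initialIdeal.1 hg.1
  obtain ⟨h, hh, hhβ⟩ := monomial_mem_initialIdeal.1 hg.2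
  refine monomial_mem_initialIdeal.2 ⟨f * h, ?_, hfα.mul hhβ⟩
  refine Ideal.map_mono hL ?_
  rw [Ideal.map_mul]
  exact Ideal.mul_mem_mul hf hh

theorem monomial_mem_genericInitialIdeal_mono {J K : Ideal (CoordRing k n)} (h : J ≤ K)
    {α : Fin (n + 1) →₀ ℕ} (hα : monomial α 1 ∈ genericInitialIdeal J) :
    monomial α 1 ∈ genericInitialIdeal K := by
  rw [monomial_mem_genericInitialIdeal] at *
  refine hα.mono fun g hg => ?_
  obtain ⟨f, hf, hfα⟩ := monomial_mem_initialIdeal.1 hg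
  exact monomial_mem_initialIdeal.2 ⟨f, Ideal.map_mono h hf, hfα⟩

theorem monomial_mem_genericInitialIdeal_of_add_single {J : Ideal (CoordRing k n)}
    (hJ : ContainsComponents J)
    (hsat : ForGenericGL fun g =>
      ∀ f, X (Fin.last n) * f ∈ J.map (coordChange g) → f ∈ J.map (coordChange g))
    {α : Fin (n + 1) →₀ ℕ}
    (hα : monomial (Finsupp.single (Fin.last n) 1 + α) 1 ∈ genericInitialIdeal J) :
    monomial α 1 ∈ genericInitialIdeal J := by
  rw [monomial_mem_genericInitialIdeal] at *
  exact (hα.and hsat).mono fun g hg =>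
    monomial_mem_initialIdeal_of_add_single (hJ.map_coordChange g) hg.2 hg.1

open Classical in
/-- The Hilbert function counts the monomials outside the generic initial ideal. -/
theorem hilbertFunction_eq_card [Infinite k] {J : Ideal (CoordRing k n)}
    (hJ : ContainsComponents J) (d : ℕ) :
    hilbertFunction J d = (Finset.univ.filter fun α : DegExp n d =>
      monomial α.1 (1 : k) ∉ genericInitialIdeal J).card := by
  obtain ⟨B, hBcard, hB⟩ := exists_generic_leads J d
  have hmem : ∀ α : DegExp n d, monomial α.1 (1 : k) ∈ genericInitialIdeal J ↔ α ∈ B := by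
    intro α
    rw [monomial_mem_genericInitialIdeal]
    constructor
    · intro h
      obtain ⟨g, hg, hgB⟩ := h.exists_and hB
      rw [← hgB, mem_leads_degPart (hJ.map_coordChange g)]
      exact hg
    · intro hα
      refine hB.mono fun g hgB => ?_
      rw [← hgB, mem_leads_degPart (hJ.map_coordChange g)] at hα
      exact hα
  have h1 := hilbertFunction_add_finrank J d
  have h2 := Finset.card_filter_add_card_filter_not (s := (Finset.univ : Finset (DegExp n d)))
    (· ∈ B)
  simp only [hmem]
  rw [Finset.filter_mem_eq_inter, Finset.univ_inter, hBcard, Finset.card_univ] at h2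
  omega

end Generic

/-! ### Scaling of the variables -/

section Scaling

open MvPolynomial

variable {k : Type*} [Field k] {n : ℕ}

/-- The scalar matrix with diagonal entries `c`. -/
def scalarGL (n : ℕ) (c : kˣ) : GL (Fin (n + 1)) k :=
  Units.map (Matrix.scalar (Fin (n + 1))).toMonoidHom c

theorem coordChange_scalarGL_monomial (c : kˣ) (α : Fin (n + 1) →₀ ℕ) (r : k) :
    coordChange (scalarGL n c) (monomial α r) = C ((c : k) ^ α.degree) * monomial α r := by
  have hX : ∀ i, ∑ j, C ((scalarGL n c).1 i j) * X j = C (c : k) * X i := by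
    intro i
    rw [Finset.sum_eq_single i]
    · simp [scalarGL]
    · intro j _ hj
      simp [scalarGL, Matrix.diagonal_apply_ne _ hj.symm]
    · simp
  rw [coordChange, aeval_monomial]
  simp only [hX, mul_pow]
  rw [monomial_eq, Finsupp.prod_mul, algebraMap_eq, Finsupp.degree_apply, ← Finset.prod_pow_eq_pow_sum,
    map_prod]
  simp only [Finsupp.prod, map_pow]
  ring

theorem coordChange_scalarGL_of_isHomogeneous (c : kˣ) {f : CoordRing k n} {d : ℕ}
    (hf : f.IsHomogeneous d) : coordChange (scalarGL n c) f = (c : k) ^ d • f := by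
  conv_lhs => rw [f.as_sum]
  conv_rhs => rw [f.as_sum]
  rw [map_sum, Finset.smul_sum]
  refine Finset.sum_congr rfl fun α hα => ?_
  have hd : α.degree = d := by
    by_contra hd
    exact mem_support_iff.1 hα (hf.coeff_eq_zero hd)
  rw [coordChange_scalarGL_monomial, smul_eq_C_mul, hd]

theorem coordChange_scalarGL (c : kˣ) (f : CoordRing k n) :
    coordChange (scalarGL n c) f =
      ∑ d ∈ Finset.range (f.totalDegree + 1), (c : k) ^ d • homogeneousComponent d f := by
  conv_lhs => rw [← sum_homogeneousComponent f, map_sum]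
  exact Finset.sum_congr rfl fun d _ =>
    coordChange_scalarGL_of_isHomogeneous c (homogeneousComponent_isHomogeneous d f)

theorem ContainsComponents.coordChange_scalarGL_mem {J : Ideal (CoordRing k n)}
    (hJ : ContainsComponents J) (c : kˣ) {f : CoordRing k n} (hf : f ∈ J) :
    coordChange (scalarGL n c) f ∈ J := by
  rw [coordChange_scalarGL]
  refine J.sum_mem fun d _ => ?_
  rw [smul_eq_C_mul]
  exact J.mul_mem_left _ (hJ f hf d)

/-- An ideal that is invariant under scaling of the variables is homogeneous. -/
theorem containsComponents_of_coordChange_scalarGL_mem [Infinite k] {J : Ideal (CoordRing k n)}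
    (h : ∀ c : kˣ, ∀ f ∈ J, coordChange (scalarGL n c) f ∈ J) : ContainsComponents J := by
  intro f hf d
  by_contra hd
  -- Separate the missing component from `J` by a functional `ψ`. Applied to `f` scaled by c, it is
  -- a polynomial in c that vanishes at every nonzero c, so all its coefficients vanish, including
  -- the one at `d`.
  obtain ⟨ψ, hψ, hker⟩ := Submodule.exists_le_ker_of_notMem (p := J.restrictScalars k) hd
  let p : Polynomial k := ∑ e ∈ Finset.range (f.totalDegree + 1),
    Polynomial.monomial e (ψ (homogeneousComponent e f))
  have hp : p = 0 := by
    refine Polynomial.eq_zero_of_infinite_isRoot p (Set.Infinite.mono (s := {0}ᶜ) ?_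
      (Set.finite_singleton 0).infinite_compl)
    intro c hc
    have h1 : ψ (coordChange (scalarGL n (Units.mk0 c hc)) f) = 0 := hker (h _ f hf)
    rw [coordChange_scalarGL, map_sum] at h1
    change p.eval c = 0
    rw [Polynomial.eval_finsetSum, ← h1]
    refine Finset.sum_congr rfl fun e _ => ?_
    rw [Polynomial.eval_monomial, map_smul, smul_eq_mul, mul_comm]
    rfl
  by_cases hdt : d < f.totalDegree + 1
  · apply hψ
    have h2 : p.coeff d = 0 := by rw [hp, Polynomial.coeff_zero]
    rw [Polynomial.finsetSum_coeff, Finset.sum_eq_single d] at h2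
    · simpa using h2
    · intro e _ hed
      exact Polynomial.coeff_monomial_of_ne _ hed.symm
    · intro hd'
      exact absurd (Finset.mem_range.2 hdt) hd'
  · apply hd
    rw [homogeneousComponent_eq_zero _ _ (by omega)]
    exact J.zero_mem

end Scaling

/-! ### Symbolic powers -/

section Symbolic

open MvPolynomial

variable {k : Type*} [Field k] {n : ℕ}

theorem mem_symbolicPower {I : Ideal (CoordRing k n)} {m : ℕ} {f : CoordRing k n} :
    f ∈ symbolicPower I m ↔ ∀ Q ∈ associatedPrimes (CoordRing k n) (CoordRing k n ⧸ I),
      ∃ s ∉ Q, s * f ∈ I ^ m := by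
  simp only [symbolicPower, Ideal.mem_iInf, Ideal.mem_comap, Subtype.forall]
  refine forall₂_congr fun Q hQ => ?_
  have : Q.IsPrime := hQ.1
  rw [IsLocalization.algebraMap_mem_map_algebraMap_iff Q.primeCompl]
  rfl

theorem pow_le_symbolicPower (I : Ideal (CoordRing k n)) (m : ℕ) : I ^ m ≤ symbolicPower I m :=
  fun f hf => mem_symbolicPower.2 fun Q hQ =>
    ⟨1, (Ideal.ne_top_iff_one Q).1 hQ.1.ne_top, by rwa [one_mul]⟩

theorem symbolicPower_antitone (I : Ideal (CoordRing k n)) : Antitone (symbolicPower I) := by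
  intro m l hml f hf
  rw [mem_symbolicPower] at hf ⊢
  intro Q hQ
  obtain ⟨s, hs, hsf⟩ := hf Q hQ
  exact ⟨s, hs, Ideal.pow_le_pow_right hml hsf⟩

theorem symbolicPower_mul_le (I : Ideal (CoordRing k n)) (m l : ℕ) :
    symbolicPower I m * symbolicPower I l ≤ symbolicPower I (m + l) := by
  rw [Ideal.mul_le]
  intro f hf g hg
  rw [mem_symbolicPower] at hf hg ⊢
  intro Q hQ
  obtain ⟨s, hs, hsf⟩ := hf Q hQ
  obtain ⟨t, ht, htg⟩ := hg Q hQ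
  refine ⟨s * t, fun h => (hQ.1.mem_or_mem h).elim hs ht, ?_⟩
  rw [mul_mul_mul_comm, pow_add]
  exact Ideal.mul_mem_mul hsf htg

theorem mem_associatedPrimes_quotient {I Q : Ideal (CoordRing k n)} :
    Q ∈ associatedPrimes (CoordRing k n) (CoordRing k n ⧸ I) ↔
      Q.IsPrime ∧ ∃ f, ∀ r, r ∈ Q ↔ r * f ∈ I := by
  rw [AssociatedPrimes.mem_iff, isAssociatedPrime_iff, Ideal.Quotient.mk_surjective.exists]
  refine and_congr_right fun _ => exists_congr fun f => ?_
  rw [SetLike.ext_iff]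
  refine forall_congr' fun r => ?_
  rw [Submodule.mem_colon_singleton, Submodule.mem_bot,
    ← Ideal.Quotient.eq_zero_iff_mem (I := I)]
  rfl

/-- A scaling is an automorphism preserving the homogeneous ideal `I`, so it permutes the associated
primes; the annihilated element is carried along by the inverse scaling. -/
theorem comap_scalarGL_mem_associatedPrimes {I Q : Ideal (CoordRing k n)}
    (hI : ContainsComponents I) (c : kˣ)
    (hQ : Q ∈ associatedPrimes (CoordRing k n) (CoordRing k n ⧸ I)) :
    Q.comap (coordChange (scalarGL n c)) ∈
      associatedPrimes (CoordRing k n) (CoordRing k n ⧸ I) := by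
  rw [mem_associatedPrimes_quotient] at hQ ⊢
  obtain ⟨hprime, f, hf⟩ := hQ
  have hinv : (scalarGL n c)⁻¹ = scalarGL n c⁻¹ := (map_inv _ _).symm
  refine ⟨Ideal.comap_isPrime _ _, coordChange (scalarGL n c)⁻¹ f, fun r => ?_⟩
  rw [Ideal.mem_comap, hf]
  constructor
  · intro h
    have := hI.coordChange_scalarGL_mem c⁻¹ h
    rwa [← hinv, map_mul, coordChange_inv_coordChange] at this
  · intro h
    have := hI.coordChange_scalarGL_mem c h
    rwa [map_mul, coordChange_coordChange_inv] at this

/-- Scaling invariance replaces a proof that the associated primes are homogeneous: a denominator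
outside the pulled-back prime is scaled to one outside `Q`. -/
theorem ContainsComponents.symbolicPower [Infinite k] {I : Ideal (CoordRing k n)}
    (hI : ContainsComponents I) (m : ℕ) : ContainsComponents (symbolicPower I m) := by
  refine containsComponents_of_coordChange_scalarGL_mem fun c f hf => ?_
  rw [mem_symbolicPower] at hf ⊢
  intro Q hQ
  obtain ⟨s, hs, hsf⟩ := hf _ (comap_scalarGL_mem_associatedPrimes hI c hQ)
  refine ⟨coordChange (scalarGL n c) s, hs, ?_⟩
  rw [← map_mul]
  have h1 : (I ^ m).map (coordChange (scalarGL n c)) ≤ I ^ m := by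
    rw [Ideal.map_pow]
    refine Ideal.pow_right_mono (Ideal.map_le_iff_le_comap.2 fun g hg => ?_) m
    exact hI.coordChange_scalarGL_mem c hg
  exact h1 (Ideal.mem_map_of_mem _ hsf)

/-- A radical homogeneous ideal with the irrelevant ideal as an associated prime contains all
variables. -/
theorem X_mem_of_forall_X_mem_associatedPrime {I Q : Ideal (CoordRing k n)}
    (hI : ContainsComponents I) (hrad : I.IsRadical)
    (hQ : Q ∈ associatedPrimes (CoordRing k n) (CoordRing k n ⧸ I)) (hX : ∀ i, X i ∈ Q)
    (i : Fin (n + 1)) : X i ∈ I := by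
  obtain ⟨hprime, f, hf⟩ := mem_associatedPrimes_quotient.1 hQ
  have hfI : f ∉ I := fun h => hprime.ne_top
    ((Ideal.eq_top_iff_one Q).2 ((hf 1).2 (by rwa [one_mul])))
  -- Without a constant term `f` would lie in `Q`, which annihilates `f` modulo `I`. Then f² ∈ I,
  -- and radicality gives the contradiction f ∈ I.
  have hf0 : coeff 0 f ≠ 0 := by
    intro h0
    have hfQ : f ∈ Q := by
      rw [f.as_sum]
      refine Q.sum_mem fun α hα => ?_
      have hα0 : α ≠ 0 := by
        rintro rfl
        exact mem_support_iff.1 hα h0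
      obtain ⟨j, hj⟩ := DFunLike.ne_iff.1 hα0
      refine Q.mem_of_dvd ?_ (hX j)
      rw [X_dvd_monomial]
      exact Or.inr hj
    refine hfI (hrad ⟨2, ?_⟩)
    rw [pow_two]
    exact (hf f).1 hfQ
  -- The degree one component of `X i * f` is `X i` times the nonzero constant term of `f`.
  have h1 := hI _ ((hf (X i)).1 (hX i)) 1
  have h2 : homogeneousComponent 1 (X i * f) = C (coeff 0 f) * X i := by
    ext α
    rw [coeff_homogeneousComponent, coeff_C_mul, coeff_X_mul', coeff_X]
    by_cases hα : Finsupp.single i 1 = α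
    · subst hα
      simp
    · rw [if_neg hα, mul_zero]
      split_ifs with hd hi
      · exfalso
        apply hα
        have hle : Finsupp.single i 1 ≤ α := by
          rw [Finsupp.single_le_iff]
          exact Nat.one_le_iff_ne_zero.2 (Finsupp.mem_support_iff.1 hi)
        have h3 := congrArg Finsupp.degree (add_tsub_cancel_of_le hle)
        rw [map_add, hd, Finsupp.degree_single] at h3
        have h4 := (Finsupp.degree_eq_zero_iff _).1 (Nat.add_left_cancel (h3.trans (add_zero 1).symm))
        exact le_antisymm hle (tsub_eq_zero_iff_le.1 h4)
      · rfl
      · rfl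
  rw [h2] at h1
  have h3 := I.mul_mem_left (C (coeff 0 f)⁻¹) h1
  rwa [← mul_assoc, ← C_mul, inv_mul_cancel₀ hf0, C_1, one_mul] at h3

/-- A generic linear form avoids a prime that does not contain all variables. -/
theorem forGenericGL_coordChange_inv_notMem {Q : Ideal (CoordRing k n)} {j : Fin (n + 1)}
    (hj : X j ∉ Q) (i : Fin (n + 1)) :
    ForGenericGL fun g => coordChange g⁻¹ (X i) ∉ Q := by
  classical
  obtain ⟨ψ, hψ, hker⟩ := Submodule.exists_le_ker_of_notMem (p := Q.restrictScalars k) hj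
  -- Up to the factor 1/det, this is `ψ` of the linear form that `g⁻¹` makes out of `X i`; the
  -- adjugate clears the denominator.
  let P : MvPolynomial (Fin (n + 1) × Fin (n + 1)) k :=
    ∑ l, (Matrix.mvPolynomialX (Fin (n + 1)) (Fin (n + 1)) k).adjugate i l * C (ψ (X l))
  have hlin : ∀ g : GL (Fin (n + 1)) k,
      ψ (coordChange g (X i)) = ∑ l, g.1 i l * ψ (X l) := by
    intro g
    rw [coordChange_X, map_sum]
    simp only [← smul_eq_C_mul, map_smul, smul_eq_mul]
  have hP : ∀ g : GL (Fin (n + 1)) k, ψ (coordChange g⁻¹ (X i)) =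
      Ring.inverse g.1.det * eval (fun ij => g.1 ij.1 ij.2) P := by
    intro g
    have hmat : (eval fun ij : Fin (n + 1) × Fin (n + 1) => g.1 ij.1 ij.2).mapMatrix
        (Matrix.mvPolynomialX (Fin (n + 1)) (Fin (n + 1)) k) = g.1 := by
      ext a b
      simp [Matrix.mvPolynomialX]
    have hadj : ∀ l, eval (fun ij => g.1 ij.1 ij.2)
        ((Matrix.mvPolynomialX (Fin (n + 1)) (Fin (n + 1)) k).adjugate i l) =
          g.1.adjugate i l := by
      intro l
      rw [← hmat, ← RingHom.map_adjugate, hmat]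
      rfl
    rw [hlin, map_sum, Finset.mul_sum]
    refine Finset.sum_congr rfl fun l _ => ?_
    rw [map_mul, hadj, eval_C, ← mul_assoc]
    congr 1
    rw [Matrix.coe_units_inv, Matrix.inv_def]
    rfl
  refine ⟨P, fun h0 => ?_, fun g hg hmem => ?_⟩
  -- The transposition of i and j is its own inverse and sends `X i` to `X j`, on which `ψ` does not
  -- vanish. Hence `P` is nonzero.
  · let M : Matrix (Fin (n + 1)) (Fin (n + 1)) k := (Equiv.swap i j).permMatrix k
    have hMM : M * M = 1 := by
      rw [← Matrix.permMatrix_mul, Equiv.swap_mul_self, Matrix.permMatrix_one]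
    have h1 := hP ⟨M, M, hMM, hMM⟩
    rw [h0, map_zero, mul_zero, hlin] at h1
    apply hψ
    rw [← h1]
    change _ = ∑ l, M i l * ψ (X l)
    rw [Finset.sum_eq_single j]
    · simp [M, Equiv.Perm.permMatrix, PEquiv.toMatrix_apply]
    · intro l _ hl
      simp [M, Equiv.Perm.permMatrix, PEquiv.toMatrix_apply, Ne.symm hl]
    · simp
  · have h1 : ψ (coordChange g⁻¹ (X i)) = 0 := hker hmem
    rw [hP, mul_eq_zero] at h1
    refine h1.elim (fun h => ?_) hg
    have h2 : IsUnit g.1.det := (Matrix.isUnit_iff_isUnit_det _).1 g.isUnit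
    rw [Ring.inverse_eq_inv'] at h
    exact h2.ne_zero (inv_eq_zero.1 h)

/-- There are finitely many associated primes, so a generic linear form avoids all of them; it can
then be absorbed into the denominators that define the symbolic power. -/
theorem forGenericGL_saturated {I : Ideal (CoordRing k n)}
    (h : ∀ Q ∈ associatedPrimes (CoordRing k n) (CoordRing k n ⧸ I), ∃ j, X j ∉ Q) (m : ℕ) :
    ForGenericGL fun g => ∀ f,
      X (Fin.last n) * f ∈ (symbolicPower I m).map (coordChange g) →
        f ∈ (symbolicPower I m).map (coordChange g) := by
  have hfin := associatedPrimes.finite (CoordRing k n) (CoordRing k n ⧸ I)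
  refine (ForGenericGL.forall_mem_finset hfin.toFinset (p := fun Q g =>
    coordChange g⁻¹ (X (Fin.last n)) ∉ Q) fun Q hQ => ?_).mono fun g hg f hf => ?_
  · obtain ⟨j, hj⟩ := h Q (hfin.mem_toFinset.1 hQ)
    exact forGenericGL_coordChange_inv_notMem hj _
  · rw [mem_map_coordChange, mem_symbolicPower] at hf ⊢
    intro Q hQ
    obtain ⟨s, hs, hsf⟩ := hf Q hQ
    rw [map_mul, ← mul_assoc] at hsf
    exact ⟨_, fun h => (hQ.1.mem_or_mem h).elim hs (hg Q (hfin.mem_toFinset.2 hQ)), hsf⟩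

end Symbolic

/-! ### The Euler characteristic of the Koszul complex -/

section Koszul

open MvPolynomial

variable {k : Type*} [Field k] {n : ℕ}

theorem koszulD_apply (z : Finset (Fin (n + 1)) → CoordRing k n) (s : Finset (Fin (n + 1))) :
    koszulD k n z s =
      ∑ i ∈ sᶜ, (-1) ^ (s.filter (· < i)).card * X i * z (insert i s) := rfl

/-- Inserting i and j in the two orders gives terms of opposite sign: only the larger index sees the
other one in its sign count. -/
theorem koszulD_koszulD (z : Finset (Fin (n + 1)) → CoordRing k n) :
    koszulD k n (koszulD k n z) = 0 := by
  funext s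
  simp only [koszulD_apply, Finset.mul_sum, Pi.zero_apply]
  rw [Finset.sum_sigma']
  refine Finset.sum_involution (fun x _ => ⟨x.2, x.1⟩) ?_ ?_ ?_ ?_
  · rintro ⟨i, j⟩ hx
    simp only [Finset.mem_sigma, Finset.mem_compl, Finset.mem_insert, not_or] at hx
    obtain ⟨hi, hji, hj⟩ := hx
    have hc : ∀ a b : Fin (n + 1), a ∉ s → ((insert a s).filter (· < b)).card =
        (s.filter (· < b)).card + if a < b then 1 else 0 := by
      intro a b ha
      rw [Finset.filter_insert]
      split_ifs with hab
      · rw [Finset.card_insert_of_notMem fun h => ha (Finset.mem_filter.1 h).1]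
      · rfl
    simp only
    rw [hc i j hi, hc j i hj, Finset.insert_comm i j s]
    rcases lt_or_gt_of_ne hji with h | h
    · rw [if_pos h, if_neg h.not_gt]
      ring
    · rw [if_pos h, if_neg h.not_gt]
      ring
  · rintro ⟨i, j⟩ hx _ heq
    simp only [Finset.mem_sigma, Finset.mem_compl, Finset.mem_insert, not_or] at hx
    exact hx.2.1 (congrArg Sigma.fst heq)
  · rintro ⟨i, j⟩ hx
    simp only [Finset.mem_sigma, Finset.mem_compl, Finset.mem_insert, not_or] at hx ⊢
    exact ⟨hx.2.2, Ne.symm hx.2.1, hx.1⟩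
  · rintro ⟨i, j⟩ _
    rfl

theorem mem_koszulChains {J : Ideal (CoordRing k n)} {p q : ℕ}
    {z : Finset (Fin (n + 1)) → CoordRing k n} :
    z ∈ koszulChains J p q ↔ ∀ s, z s ∈ J ∧ (s.card ≠ p → z s = 0) ∧
      ∀ α ∈ (z s).support, α.degree + p = q := Iff.rfl

theorem koszulD_mem_koszulChains {J : Ideal (CoordRing k n)} {p q : ℕ}
    {z : Finset (Fin (n + 1)) → CoordRing k n} (hz : z ∈ koszulChains J (p + 1) q) :
    koszulD k n z ∈ koszulChains J p q := by
  rw [mem_koszulChains] at *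
  intro s
  rw [koszulD_apply]
  refine ⟨J.sum_mem fun i _ => J.mul_mem_left _ (hz _).1, fun hs => ?_, fun α hα => ?_⟩
  · refine Finset.sum_eq_zero fun i hi => ?_
    rw [(hz (insert i s)).2.1, mul_zero]
    rw [Finset.card_insert_of_notMem (Finset.mem_compl.1 hi)]
    omega
  · rw [mem_support_iff, coeff_sum] at hα
    obtain ⟨i, -, hi⟩ := Finset.exists_ne_zero_of_sum_ne_zero hα
    rw [show (-1 : CoordRing k n) ^ (s.filter (· < i)).card * X i * z (insert i s) =
      C ((-1) ^ (s.filter (· < i)).card) * (X i * z (insert i s)) by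
        rw [map_pow, map_neg, map_one, mul_assoc], coeff_C_mul, coeff_X_mul'] at hi
    split_ifs at hi with his
    · have h1 := (hz (insert i s)).2.2 _ (mem_support_iff.2 (right_ne_zero_of_mul hi))
      have hle : Finsupp.single i 1 ≤ α := by
        rw [Finsupp.single_le_iff]
        exact Nat.one_le_iff_ne_zero.2 (Finsupp.mem_support_iff.1 his)
      have h3 := congrArg Finsupp.degree (add_tsub_cancel_of_le hle)
      rw [map_add, Finsupp.degree_single] at h3
      omega
    · exact absurd (mul_zero _) hi

instance finite_degPart (J : Ideal (CoordRing k n)) (d : ℕ) : Module.Finite k (degPart J d) :=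
  Submodule.finiteDimensional_of_le (S₂ := homogeneousSubmodule (Fin (n + 1)) k d) inf_le_right

open Classical in
/-- The Koszul chains are families of elements of `J` of the appropriate degree. -/
def koszulChainsEquiv (J : Ideal (CoordRing k n)) {p q : ℕ} (hpq : p ≤ q) :
    koszulChains J p q ≃ₗ[k]
      ({s : Finset (Fin (n + 1)) // s.card = p} → degPart J (q - p)) where
  toFun z s := ⟨z.1 s.1, (z.2 s.1).1, (mem_homogeneousSubmodule _ _).2 (by
    intro α hα
    have := (z.2 s.1).2.2 α (mem_support_iff.2 hα)
    change Finsupp.weight (fun _ => 1) α = q - p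
    rw [← Finsupp.degree_eq_weight_one]
    omega)⟩
  map_add' z w := rfl
  map_smul' c z := rfl
  invFun w := ⟨fun s => if h : s.card = p then (w ⟨s, h⟩).1 else 0, by
    intro s
    by_cases h : s.card = p
    · simp only [h, dif_pos]
      refine ⟨(w ⟨s, h⟩).2.1, fun h => absurd rfl h, fun α hα => ?_⟩
      by_contra hd
      refine mem_support_iff.1 hα ((mem_degPart.1 (w ⟨s, h⟩).2).2.coeff_eq_zero ?_)
      omega
    · simp [h]⟩
  left_inv z := by
    refine Subtype.ext (funext fun s => ?_)
    by_cases h : s.card = p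
    · simp [h]
    · simp [h, (z.2 s).2.1 h]
  right_inv w := by
    refine funext fun s => Subtype.ext ?_
    simp [s.2]

theorem finrank_koszulChains (J : Ideal (CoordRing k n)) {p q : ℕ} (hpq : p ≤ q) :
    Module.finrank k (koszulChains J p q) =
      (n + 1).choose p * Module.finrank k (degPart J (q - p)) := by
  rw [(koszulChainsEquiv J hpq).finrank_eq, Module.finrank_pi_fintype]
  simp

theorem finite_koszulChains (J : Ideal (CoordRing k n)) {p q : ℕ} (hpq : p ≤ q) :
    Module.Finite k (koszulChains J p q) :=
  Module.Finite.equiv (koszulChainsEquiv J hpq).symm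

/-- The space of boundaries of the Koszul complex. -/
def koszulBoundaries (J : Ideal (CoordRing k n)) (p q : ℕ) :
    Submodule k (Finset (Fin (n + 1)) → CoordRing k n) :=
  (koszulChains J p q).map (koszulD k n)

/-- Rank-nullity, with the cycles identified with boundaries by exactness. Here `koszulBoundaries J
p q` is the image of the p-chains, so it sits in homological degree p - 1. -/
theorem finrank_koszulChains_of_subsingleton (J : Ideal (CoordRing k n)) {p q : ℕ} (hpq : p ≤ q)
    (h : Subsingleton (koszulTor J p q)) :
    Module.finrank k (koszulChains J p q) =
      Module.finrank k (koszulBoundaries J p q) + Module.finrank k (koszulBoundaries J (p + 1) q) := by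
  have hfin := finite_koszulChains J hpq
  have hex : koszulBoundaries J (p + 1) q = koszulChains J p q ⊓ LinearMap.ker (koszulD k n) := by
    apply le_antisymm
    · rintro _ ⟨z, hz, rfl⟩
      exact ⟨koszulD_mem_koszulChains hz, koszulD_koszulD z⟩
    · rw [Submodule.Quotient.subsingleton_iff, Submodule.submoduleOf,
        Submodule.comap_subtype_eq_top] at h
      exact h
  have h1 := LinearMap.finrank_range_add_finrank_ker
    ((koszulD k n).domRestrict (koszulChains J p q))
  rw [← h1, hex, LinearMap.range_domRestrict, LinearMap.ker_domRestrict]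
  congr 1
  rw [← Submodule.finrank_map_subtype_eq, Submodule.map_comap_subtype]

theorem koszulBoundaries_zero (J : Ideal (CoordRing k n)) (q : ℕ) :
    koszulBoundaries J 0 q = ⊥ := by
  rw [eq_bot_iff]
  rintro _ ⟨z, hz, rfl⟩
  rw [Submodule.mem_bot]
  funext s
  rw [koszulD_apply]
  refine Finset.sum_eq_zero fun i _ => ?_
  rw [(hz (insert i s)).2.1, mul_zero]
  exact Finset.card_ne_zero_of_mem (Finset.mem_insert_self i s)

theorem koszulBoundaries_eq_bot (J : Ideal (CoordRing k n)) {p : ℕ} (hp : n + 1 < p) (q : ℕ) :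
    koszulBoundaries J p q = ⊥ := by
  rw [eq_bot_iff]
  rintro _ ⟨z, hz, rfl⟩
  have hz0 : z = 0 := by
    funext s
    refine (hz s).2.1 (fun h => ?_)
    have := Finset.card_le_univ s
    rw [Fintype.card_fin] at this
    omega
  rw [hz0, map_zero]
  exact Submodule.zero_mem _

/-- The Euler characteristic of an exact complex vanishes: the partial sums telescope to a single
boundary dimension, which is zero past the length of the complex. The bound on `q` keeps `q - p` a
true difference. -/
theorem sum_finrank_degPart_eq_zero (J : Ideal (CoordRing k n)) {q : ℕ} (hq : n + 1 ≤ q)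
    (h : ∀ p ≤ n + 1, Subsingleton (koszulTor J p q)) :
    ∑ p ∈ Finset.range (n + 2),
      (-1 : ℤ) ^ p * ((n + 1).choose p * Module.finrank k (degPart J (q - p)) : ℕ) = 0 := by
  have key : ∀ N ≤ n + 2, ∑ p ∈ Finset.range N,
      (-1 : ℤ) ^ p * ((n + 1).choose p * Module.finrank k (degPart J (q - p)) : ℕ) =
        - (-1 : ℤ) ^ N * (Module.finrank k (koszulBoundaries J N q) : ℤ) := by
    intro N
    induction N with
    | zero =>
      intro _
      rw [koszulBoundaries_zero, finrank_bot]
      simp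
    | succ N ih =>
      intro hN
      rw [Finset.sum_range_succ, ih (by omega), ← finrank_koszulChains J (by omega : N ≤ q),
        finrank_koszulChains_of_subsingleton J (by omega) (h N (by omega))]
      push_cast
      ring
  rw [key _ le_rfl, koszulBoundaries_eq_bot J (by omega), finrank_bot]
  simp

theorem subsingleton_koszulTor {J : Ideal (CoordRing k n)} {c : ℝ}
    (hJ : regularity J ≤ (c : EReal)) {p q : ℕ} (h : c + p < q) :
    Subsingleton (koszulTor J p q) := by
  by_contra hn
  rw [not_subsingleton_iff_nontrivial] at hn
  have h1 : (((q : ℝ) - (p : ℝ) : ℝ) : EReal) ≤ regularity J :=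
    le_iSup_of_le p (le_iSup_of_le q (le_iSup_of_le hn le_rfl))
  have h2 := EReal.coe_le_coe_iff.1 (h1.trans hJ)
  linarith

end Koszul

/-! ### Hilbert polynomials -/

section HilbertPolynomial

theorem fwdDiff_iter_eq_zero_of_le {f : ℕ → ℤ} {Y N : ℕ} (h : ∀ y ≥ Y, (fwdDiff 1)^[N] f y = 0)
    {j : ℕ} (hj : N ≤ j) : ∀ y ≥ Y, (fwdDiff 1)^[j] f y = 0 := by
  induction j, hj using Nat.le_induction with
  | base => exact h
  | succ j _ ih =>
    intro y hy
    rw [Function.iterate_succ_apply', fwdDiff, ih y hy, ih (y + 1) (by omega), sub_zero]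

/-- A function on `ℕ` whose `N`-th differences vanish from `Y` on agrees from `Y` on with a
polynomial of degree less than `N`. -/
theorem exists_polynomial_of_fwdDiff_iter_eq_zero {f : ℕ → ℤ} {Y N : ℕ}
    (h : ∀ y ≥ Y, (fwdDiff 1)^[N] f y = 0) :
    ∃ P : Polynomial ℚ, P.degree < N ∧ ∀ y ≥ Y, P.eval (y : ℚ) = f y := by
  -- Newton's forward difference formula based at `Y`, cut off before order `N`.
  refine ⟨∑ j ∈ Finset.range N, Polynomial.C ((((fwdDiff 1)^[j] f Y : ℤ) : ℚ) / (j.factorial : ℚ)) *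
    (descPochhammer ℚ j).comp (Polynomial.X - Polynomial.C (Y : ℚ)), ?_, fun y hy => ?_⟩
  · rw [← Polynomial.mem_degreeLT]
    refine Submodule.sum_mem _ fun j hj => ?_
    rw [Polynomial.mem_degreeLT]
    have hd : (Polynomial.C ((((fwdDiff 1)^[j] f Y : ℤ) : ℚ) / (j.factorial : ℚ)) *
        (descPochhammer ℚ j).comp (Polynomial.X - Polynomial.C (Y : ℚ))).natDegree ≤ j := by
      refine (Polynomial.natDegree_C_mul_le _ _).trans ?_
      rw [Polynomial.natDegree_comp, descPochhammer_natDegree, Polynomial.natDegree_X_sub_C,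
        mul_one]
    refine (Polynomial.degree_le_of_natDegree_le hd).trans_lt ?_
    exact_mod_cast Finset.mem_range.1 hj
  · obtain ⟨j, rfl⟩ := Nat.exists_eq_add_of_le hy
    have h1 := shift_eq_sum_fwdDiff_iter (1 : ℕ) f j Y
    rw [smul_eq_mul, mul_one] at h1
    have h2 : ∑ i ∈ Finset.range (j + 1), j.choose i • (fwdDiff 1)^[i] f Y =
        ∑ i ∈ Finset.range N, j.choose i • (fwdDiff 1)^[i] f Y := by
      rcases le_total (j + 1) N with hN | hN
      · refine Finset.sum_subset (Finset.range_mono hN) fun i _ hi => ?_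
        rw [Nat.choose_eq_zero_of_lt (by simpa using hi), zero_smul]
      · refine (Finset.sum_subset (Finset.range_mono hN) fun i _ hi => ?_).symm
        rw [fwdDiff_iter_eq_zero_of_le h (by simpa using hi) Y le_rfl, smul_zero]
    rw [h1, h2, Polynomial.eval_finsetSum]
    push_cast
    refine Finset.sum_congr rfl fun i _ => ?_
    rw [Polynomial.eval_mul, Polynomial.eval_C, Polynomial.eval_comp, Polynomial.eval_sub,
      Polynomial.eval_X, Polynomial.eval_C, add_sub_cancel_left, nsmul_eq_mul,
      Int.cast_mul, Int.cast_natCast, Nat.cast_choose_eq_descPochhammer_div ℚ]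
    ring

theorem card_degExp (n d : ℕ) : Fintype.card (DegExp n d) = (d + n).choose n := by
  classical
  have h := Finset.card_finsuppAntidiag_nat_eq_choose (s := (Finset.univ : Finset (Fin (n + 1)))) d
  rw [Finset.card_univ, Fintype.card_fin, show n + 1 + d - 1 = d + n by omega] at h
  rw [← Nat.choose_symm_add, ← h, ← Fintype.card_coe]
  refine Fintype.card_congr (Equiv.subtypeEquivRight fun α => ?_)
  rw [Finset.mem_finsuppAntidiag, Finsupp.degree_eq_sum]
  simp

variable {k : Type*} [Field k] {n : ℕ}

theorem fwdDiff_iter_hilbertFunction {J : Ideal (CoordRing k n)} {c : ℝ}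
    (hJ : regularity J ≤ (c : EReal)) {y : ℕ} (hy : c < y) :
    (fwdDiff 1)^[n + 1] (fun d => (hilbertFunction J d : ℤ)) y = 0 := by
  have h1 : (fun d => (hilbertFunction J d : ℤ)) =
      (fun d => ((d + n).choose n : ℤ)) +
        (-1 : ℤ) • fun d => (Module.finrank k (degPart J d) : ℤ) := by
    funext d
    have := hilbertFunction_add_finrank J d
    rw [card_degExp] at this
    simp only [Pi.add_apply, Pi.smul_apply, smul_eq_mul]
    omega
  have h2 : (fwdDiff 1)^[n + 1] (fun d => ((d + n).choose n : ℤ)) y = 0 := by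
    rw [fwdDiff_iter_comp_add 1 (fun d => (d.choose n : ℤ)) n, Function.iterate_succ_apply']
    have := fwdDiff_iter_choose 0 n
    rw [add_zero] at this
    rw [this]
    simp [fwdDiff]
  have h3 : (fwdDiff 1)^[n + 1] (fun d => (Module.finrank k (degPart J d) : ℤ)) y = 0 := by
    -- The (n+1)-st difference at y is the Koszul Euler characteristic in internal degree y + n + 1,
    -- after p ↦ n + 1 - p in the sum over shifts. That degree exceeds c + p for all p ≤ n + 1.
    rw [fwdDiff_iter_eq_sum_shift, ← Finset.sum_range_reflect]
    rw [← sum_finrank_degPart_eq_zero J (q := y + (n + 1)) (by omega)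
      fun p hp => subsingleton_koszulTor hJ ?_]
    · refine Finset.sum_congr rfl fun p hp => ?_
      have hp' : p ≤ n + 1 := Nat.lt_succ_iff.1 (Finset.mem_range.1 hp)
      rw [show n + 1 + 1 - 1 - p = n + 1 - p by omega, Nat.choose_symm hp',
        Nat.sub_sub_self hp', smul_eq_mul, smul_eq_mul, mul_one,
        Nat.add_sub_assoc hp', mul_assoc]
      push_cast
      rfl
    · have : (p : ℝ) ≤ n + 1 := by exact_mod_cast hp
      push_cast
      linarith
  rw [h1, fwdDiff_iter_add, fwdDiff_iter_const_smul, Pi.add_apply, Pi.smul_apply, h2, h3,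
    smul_zero, add_zero]

/-- The Hilbert function agrees with the Hilbert polynomial, which has degree at most `n`, in
degrees above the regularity. -/
theorem eval_hilbertPolynomial_eq {J : Ideal (CoordRing k n)} {c : ℝ}
    (hJ : regularity J ≤ (c : EReal)) :
    (hilbertPolynomial J).degree < (n + 1 : ℕ) ∧
      ∀ y : ℕ, c < y → (hilbertPolynomial J).eval (y : ℚ) = hilbertFunction J y := by
  obtain ⟨N, hN⟩ := exists_nat_gt c
  -- The base point is any degree above `c`. Uniqueness identifies all the resulting polynomials, so
  -- agreement starts right above `c` and is not merely eventual.
  have h : ∀ Y : ℕ, c < Y → (hilbertPolynomial J).degree < (n + 1 : ℕ) ∧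
      (hilbertPolynomial J).eval (Y : ℚ) = hilbertFunction J Y := by
    intro Y hY
    obtain ⟨P, hP, hPy⟩ := exists_polynomial_of_fwdDiff_iter_eq_zero
      (f := fun d => (hilbertFunction J d : ℤ)) (Y := Y) (N := n + 1) fun y hy =>
        fwdDiff_iter_hilbertFunction hJ (hY.trans_le (by exact_mod_cast hy))
    have hHP : hilbertPolynomial J = P := by
      refine IsHilbertPolynomial.hilbertPolynomial_eq ?_
      filter_upwards [eventually_ge_atTop Y] with y hy
      simpa using hPy y hy
    rw [hHP]
    exact ⟨hP, by simpa using hPy Y le_rfl⟩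
  exact ⟨(h N hN).1, fun y hy => (h y hy).2⟩

end HilbertPolynomial

/-! ### Counting lattice points outside a graded family -/

section GradedFamily

variable {n : ℕ}

/-- The union of the orthants `a + ℝ_{≥0}^n` with `a ∈ A`. -/
def orthants (A : Set (Fin n → ℕ)) : Set (Fin n → ℝ) :=
  {x | ∃ a ∈ A, ∀ i, (a i : ℝ) ≤ x i}

/-- A family of upward closed sets of lattice points, compatible with addition and decreasing. -/
structure IsGradedFamily (E : ℕ → Set (Fin n → ℕ)) : Prop where
  mem_of_le : ∀ {m a b}, a ∈ E m → a ≤ b → b ∈ E m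
  add_mem : ∀ {m l a b}, a ∈ E m → b ∈ E l → a + b ∈ E (m + l)
  antitone : Antitone E
  zero_mem : 0 ∈ E 0

/-- The rescaled convex hulls `conv(L_m) / m` for `m ≥ 1`. -/
def scaledHull (E : ℕ → Set (Fin n → ℕ)) (m : {m : ℕ // 1 ≤ m}) : Set (Fin n → ℝ) :=
  (fun x => (m.1 : ℝ)⁻¹ • x) '' convexHull ℝ (orthants (E m.1))

/-- The closure of the complement of all rescaled convex hulls in the positive orthant. -/
def limitingShape (E : ℕ → Set (Fin n → ℕ)) : Set (Fin n → ℝ) :=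
  closure (⋂ m : {m : ℕ // 1 ≤ m}, {x : Fin n → ℝ | ∀ i, 0 ≤ x i} \ scaledHull E m)

/-- The lattice points outside the `m`-th set whose coordinates have sum at most `m t`. -/
def outsidePoints (E : ℕ → Set (Fin n → ℕ)) (t m : ℕ) : Set (Fin n → ℕ) :=
  {a | ∑ i, a i ≤ m * t ∧ a ∉ E m}

variable {E : ℕ → Set (Fin n → ℕ)}

theorem IsGradedFamily.nsmul_mem (hE : IsGradedFamily E) {p : ℕ} {a : Fin n → ℕ} (ha : a ∈ E p)
    (c : ℕ) : c • a ∈ E (c * p) := by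
  induction c with
  | zero => simpa using hE.zero_mem
  | succ c ih =>
    rw [succ_nsmul, Nat.succ_mul]
    exact hE.add_mem ih ha

theorem IsGradedFamily.sum_nsmul_mem (hE : IsGradedFamily E) {ι : Type*} (s : Finset ι) {p : ℕ}
    {a : ι → Fin n → ℕ} (ha : ∀ j ∈ s, a j ∈ E p) (c : ι → ℕ) :
    ∑ j ∈ s, c j • a j ∈ E ((∑ j ∈ s, c j) * p) := by
  classical
  induction s using Finset.induction_on with
  | empty => simpa using hE.zero_mem
  | insert j s hj ih =>
    rw [Finset.sum_insert hj, Finset.sum_insert hj, add_mul]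
    exact hE.add_mem (hE.nsmul_mem (ha j (Finset.mem_insert_self j s)) _)
      (ih fun i hi => ha i (Finset.mem_insert_of_mem hi))

open Pointwise in
theorem IsGradedFamily.scaledHull_subset (hE : IsGradedFamily E) (m l : {m : ℕ // 1 ≤ m}) :
    scaledHull E m ⊆ scaledHull E ⟨l.1 * m.1, Nat.mul_pos l.2 m.2⟩ := by
  rintro _ ⟨y, hy, rfl⟩
  have hl : (l.1 : ℝ) ≠ 0 := Nat.cast_ne_zero.2 (Nat.one_le_iff_ne_zero.1 l.2)
  refine ⟨(l.1 : ℝ) • y, ?_, ?_⟩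
  · have h1 : (l.1 : ℝ) • y ∈ convexHull ℝ ((l.1 : ℝ) • orthants (E m.1)) := by
      rw [convexHull_smul]
      exact Set.smul_mem_smul_set hy
    refine convexHull_mono ?_ h1
    rintro _ ⟨x, ⟨a, ha, hax⟩, rfl⟩
    refine ⟨l.1 • a, hE.nsmul_mem ha _, fun i => ?_⟩
    simp only [Pi.smul_apply, smul_eq_mul, Nat.cast_mul]
    exact mul_le_mul_of_nonneg_left (hax i) (Nat.cast_nonneg _)
  · simp only [Nat.cast_mul, mul_inv, smul_smul]
    congr 1
    field_simp

/-- The hulls increase along divisibility of the index, so the union is directed. Convexity is what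
makes its frontier a null set. -/
theorem IsGradedFamily.convex_iUnion (hE : IsGradedFamily E) :
    Convex ℝ (⋃ m, scaledHull E m) := by
  refine Directed.convex_iUnion (fun m l => ?_) fun m => ?_
  · refine ⟨⟨l.1 * m.1, Nat.mul_pos l.2 m.2⟩, hE.scaledHull_subset m l, ?_⟩
    have := hE.scaledHull_subset l m
    simpa only [mul_comm] using this
  · exact (convex_convexHull ℝ _).smul _

theorem floor_notMem_of_notMem_iUnion {x : Fin n → ℝ} (hx : ∀ i, 0 ≤ x i)
    (hxU : x ∉ ⋃ m, scaledHull E m) {m : ℕ} (hm : 1 ≤ m) :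
    (fun i => ⌊(m : ℝ) * x i⌋₊) ∉ E m := by
  intro h
  refine hxU (Set.mem_iUnion.2 ⟨⟨m, hm⟩, (m : ℝ) • x, subset_convexHull ℝ _ ⟨_, h, fun i => ?_⟩, ?_⟩)
  · exact Nat.floor_le (mul_nonneg (Nat.cast_nonneg m) (hx i))
  · exact inv_smul_smul₀ (Nat.cast_ne_zero.2 (Nat.one_le_iff_ne_zero.1 hm)) x

/-- Interior points of the union of the rescaled convex hulls are eventually interior to the
rescaled sets themselves. -/
theorem IsGradedFamily.eventually_floor_mem (hE : IsGradedFamily E) {x : Fin n → ℝ}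
    (hx : x ∈ interior (⋃ m, scaledHull E m)) :
    ∀ᶠ m : ℕ in atTop, (fun i => ⌊(m : ℝ) * x i⌋₊) ∈ E m := by
  have hcont : Continuous fun ε : ℝ => fun i => x i - ε := by fun_prop
  have h1 : ∀ᶠ ε : ℝ in 𝓝[>] 0, (fun i => x i - ε) ∈ ⋃ m, scaledHull E m := by
    refine nhdsWithin_le_nhds (hcont.continuousAt.eventually_mem ?_)
    simpa using mem_interior_iff_mem_nhds.1 hx
  -- Moving the interior point down by ε in every coordinate leaves slack mε after scaling by m,
  -- which will pay for rounding.
  obtain ⟨ε, hεU, hε⟩ := (h1.and self_mem_nhdsWithin).exists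
  obtain ⟨⟨p, hp⟩, w, hw, hwε⟩ := Set.mem_iUnion.1 hεU
  rw [convexHull_eq] at hw
  obtain ⟨ι, s, c, z, hc0, hc1, hz, hcz⟩ := hw
  rw [Finset.centerMass_eq_of_sum_1 _ _ hc1] at hcz
  have hz' : ∀ j, ∃ a : Fin n → ℕ, j ∈ s → a ∈ E p ∧ ∀ i, (a i : ℝ) ≤ z j i := by
    intro j
    by_cases hj : j ∈ s
    · obtain ⟨a, ha⟩ := hz j hj
      exact ⟨a, fun _ => ha⟩
    · exact ⟨0, fun h => absurd h hj⟩
  choose a ha using hz'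
  have hp0 : (0 : ℝ) < p := Nat.cast_pos.2 hp
  have hpx : ∀ i, ∑ j ∈ s, c j * (a j i : ℝ) ≤ p * (x i - ε) := by
    intro i
    have h2 := congrFun hwε i
    simp only [Pi.smul_apply, smul_eq_mul] at h2
    rw [← h2, mul_inv_cancel_left₀ hp0.ne', ← hcz, Finset.sum_apply]
    refine Finset.sum_le_sum fun j hj => ?_
    exact mul_le_mul_of_nonneg_left ((ha j hj).2 i) (hc0 j hj)
  obtain ⟨N, hN⟩ := exists_nat_ge ((∑ i, ∑ j ∈ s, (a j i : ℝ)) / ε)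
  filter_upwards [eventually_ge_atTop N] with m hm
  have hmε : (∑ i, ∑ j ∈ s, (a j i : ℝ)) ≤ m * ε :=
    (div_le_iff₀ hε).1 (hN.trans (by exact_mod_cast hm))
  -- Integer multiplicities replacing the real weights. Rounding up keeps the total level at least
  -- m, so antitonicity lands in `E m`; the cost per coordinate is at most the sum of the `a j`,
  -- below mε by the choice of `N`.
  let b : ι → ℕ := fun j => ⌈c j * m / p⌉₊
  have hb := hE.sum_nsmul_mem s (fun j hj => (ha j hj).1) b
  have hbm : m ≤ (∑ j ∈ s, b j) * p := by
    have h2 : (m : ℝ) ≤ (∑ j ∈ s, (b j : ℝ)) * p := by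
      calc (m : ℝ) = (∑ j ∈ s, c j * m / p) * p := by
            rw [← Finset.sum_div, ← Finset.sum_mul, hc1, one_mul, div_mul_cancel₀ _ hp0.ne']
        _ ≤ _ := mul_le_mul_of_nonneg_right
            (Finset.sum_le_sum fun j _ => Nat.le_ceil _) hp0.le
    exact_mod_cast h2
  refine hE.mem_of_le (hE.antitone hbm hb) fun i => Nat.le_floor ?_
  have hbj : ∀ j ∈ s, (b j : ℝ) ≤ c j * m / p + 1 := fun j hj =>
    (Nat.ceil_lt_add_one (div_nonneg (mul_nonneg (hc0 j hj) (Nat.cast_nonneg m)) hp0.le)).le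
  rw [Finset.sum_apply]
  push_cast [Pi.smul_apply, smul_eq_mul]
  calc ∑ j ∈ s, (b j : ℝ) * (a j i : ℝ)
      ≤ ∑ j ∈ s, (c j * m / p + 1) * (a j i : ℝ) :=
        Finset.sum_le_sum fun j hj => mul_le_mul_of_nonneg_right (hbj j hj) (Nat.cast_nonneg _)
    _ = m / p * (∑ j ∈ s, c j * (a j i : ℝ)) + ∑ j ∈ s, (a j i : ℝ) := by
        rw [Finset.mul_sum, ← Finset.sum_add_distrib]
        exact Finset.sum_congr rfl fun j _ => by ring
    _ ≤ m / p * (p * (x i - ε)) + m * ε := by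
        refine add_le_add (mul_le_mul_of_nonneg_left (hpx i) (by positivity)) (le_trans ?_ hmε)
        exact Finset.single_le_sum (f := fun i => ∑ j ∈ s, (a j i : ℝ))
          (fun i _ => Finset.sum_nonneg fun j _ => Nat.cast_nonneg _) (Finset.mem_univ i)
    _ = m * x i := by
        field_simp
        ring

/-- The union of the cubes of side `1 / m` at the rescaled lattice points outside `E m`. -/
def cubes (E : ℕ → Set (Fin n → ℕ)) (t m : ℕ) : Set (Fin n → ℝ) :=
  {x | (∀ i, 0 ≤ x i) ∧ (fun i => ⌊(m : ℝ) * x i⌋₊) ∈ outsidePoints E t m}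

theorem finite_outsidePoints (E : ℕ → Set (Fin n → ℕ)) (t m : ℕ) :
    (outsidePoints E t m).Finite := by
  refine (Set.finite_Iic (fun _ : Fin n => m * t)).subset fun a ha i => ?_
  exact (Finset.single_le_sum (fun _ _ => Nat.zero_le _) (Finset.mem_univ i)).trans ha.1

theorem cubes_eq_biUnion (E : ℕ → Set (Fin n → ℕ)) (t : ℕ) {m : ℕ} (hm : 1 ≤ m) :
    cubes E t m = ⋃ a ∈ (finite_outsidePoints E t m).toFinset,
      Set.pi Set.univ fun i => Set.Ico ((a i : ℝ) / m) (((a i : ℝ) + 1) / m) := by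
  have hm0 : (0 : ℝ) < m := Nat.cast_pos.2 hm
  ext x
  simp only [Set.mem_iUnion, Set.Finite.mem_toFinset, exists_prop, Set.mem_univ_pi, Set.mem_Ico]
  have hfl : ∀ a : ℕ, ∀ y : ℝ, ((a : ℝ) / m ≤ y ∧ y < ((a : ℝ) + 1) / m) ↔
      (0 ≤ y ∧ ⌊(m : ℝ) * y⌋₊ = a) := by
    intro a y
    rw [div_le_iff₀ hm0, lt_div_iff₀ hm0, mul_comm y]
    constructor
    · rintro ⟨h1, h2⟩
      have hy : 0 ≤ (m : ℝ) * y := (Nat.cast_nonneg a).trans h1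
      exact ⟨nonneg_of_mul_nonneg_right hy hm0, (Nat.floor_eq_iff hy).2 ⟨h1, h2⟩⟩
    · rintro ⟨hy, h⟩
      exact (Nat.floor_eq_iff (mul_nonneg hm0.le hy)).1 h
  simp only [hfl]
  constructor
  · rintro ⟨h1, h2⟩
    exact ⟨_, h2, fun i => ⟨h1 i, rfl⟩⟩
  · rintro ⟨a, ha, h⟩
    have : (fun i => ⌊(m : ℝ) * x i⌋₊) = a := funext fun i => (h i).2
    exact ⟨fun i => (h i).1, by rwa [this]⟩

theorem measurableSet_cubes (E : ℕ → Set (Fin n → ℕ)) (t : ℕ) {m : ℕ} (hm : 1 ≤ m) :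
    MeasurableSet (cubes E t m) := by
  rw [cubes_eq_biUnion E t hm]
  exact Finset.measurableSet_biUnion _ fun a _ =>
    MeasurableSet.univ_pi fun i => measurableSet_Ico

theorem volume_cubes (E : ℕ → Set (Fin n → ℕ)) (t : ℕ) {m : ℕ} (hm : 1 ≤ m) :
    (volume (cubes E t m)).toReal = (outsidePoints E t m).ncard / (m : ℝ) ^ n := by
  have hm0 : (0 : ℝ) < m := Nat.cast_pos.2 hm
  rw [cubes_eq_biUnion E t hm, measure_biUnion_finset]
  · have hvol : ∀ a : Fin n → ℕ, volume (Set.pi Set.univ fun i =>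
        Set.Ico ((a i : ℝ) / m) (((a i : ℝ) + 1) / m)) = ENNReal.ofReal ((m : ℝ)⁻¹) ^ n := by
      intro a
      rw [Real.volume_pi_Ico]
      simp [← sub_div]
    simp only [hvol]
    rw [Finset.sum_const, ENNReal.toReal_nsmul, ENNReal.toReal_pow,
      ENNReal.toReal_ofReal (by positivity), Set.ncard_eq_toFinset_card _ (finite_outsidePoints E t m),
      nsmul_eq_mul, inv_pow, div_eq_mul_inv]
  · intro a _ b _ hab
    rw [Function.onFun, Set.disjoint_left]
    intro x hxa hxb
    apply hab
    funext i
    have h1 := hxa i (Set.mem_univ i)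
    have h2 := hxb i (Set.mem_univ i)
    rw [Set.mem_Ico, div_le_iff₀ hm0, lt_div_iff₀ hm0] at h1 h2
    have h3 : (a i : ℝ) < b i + 1 := h1.1.trans_lt h2.2
    have h4 : (b i : ℝ) < a i + 1 := h2.1.trans_lt h1.2
    norm_cast at h3 h4
    omega
  · exact fun a _ => MeasurableSet.univ_pi fun i => measurableSet_Ico

theorem cubes_subset (E : ℕ → Set (Fin n → ℕ)) (t : ℕ) {m : ℕ} (hm : 1 ≤ m) :
    cubes E t m ⊆ Set.Icc 0 (fun _ => (t : ℝ) + 1) := by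
  rintro x ⟨hx, hxm⟩
  refine ⟨hx, fun i => ?_⟩
  have hm0 : (1 : ℝ) ≤ m := by exact_mod_cast hm
  have h1 : ⌊(m : ℝ) * x i⌋₊ ≤ m * t :=
    (Finset.single_le_sum (f := fun i => ⌊(m : ℝ) * x i⌋₊) (fun _ _ => Nat.zero_le _)
      (Finset.mem_univ i)).trans hxm.1
  have h2 := Nat.lt_floor_add_one ((m : ℝ) * x i)
  have h3 : (⌊(m : ℝ) * x i⌋₊ : ℝ) ≤ m * t := by exact_mod_cast h1
  have h4 : (m : ℝ) * x i ≤ m * (t + 1) := by linarith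
  exact le_of_mul_le_mul_left h4 (by linarith)

theorem isClosed_simplexT (t : ℝ) : IsClosed (simplexT n t) := by
  have : simplexT n t = (⋂ i, {x : Fin n → ℝ | 0 ≤ x i}) ∩ {x | ∑ i, x i ≤ t} := by
    ext x
    simp [simplexT]
  rw [this]
  exact (isClosed_iInter fun i => isClosed_le continuous_const (continuous_apply i)).inter
    (isClosed_le (by fun_prop) continuous_const)

/-- Rounding down changes the coordinate sum by at most n, whereas a strict excess over t is
multiplied by m. -/
theorem eventually_sum_floor_le_iff {x : Fin n → ℝ} (hx : ∀ i, 0 ≤ x i) (t : ℕ) :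
    ∀ᶠ m : ℕ in atTop, (∑ i, ⌊(m : ℝ) * x i⌋₊ ≤ m * t ↔ x ∈ simplexT n t) := by
  by_cases hxt : ∑ i, x i ≤ t
  · refine Eventually.of_forall fun m => iff_of_true ?_ ⟨hx, hxt⟩
    have : (∑ i, (⌊(m : ℝ) * x i⌋₊ : ℝ)) ≤ m * t := by
      refine (Finset.sum_le_sum fun i _ =>
        Nat.floor_le (mul_nonneg (Nat.cast_nonneg m) (hx i))).trans ?_
      rw [← Finset.mul_sum]
      exact mul_le_mul_of_nonneg_left hxt (Nat.cast_nonneg m)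
    exact_mod_cast this
  · push Not at hxt
    obtain ⟨N, hN⟩ := exists_nat_ge ((n : ℝ) / (∑ i, x i - t))
    filter_upwards [eventually_ge_atTop N] with m hm
    refine iff_of_false (fun h => ?_) fun h => absurd h.2 (not_le.2 hxt)
    have h1 : (∑ i, (⌊(m : ℝ) * x i⌋₊ : ℝ)) ≤ m * t := by exact_mod_cast h
    have h2 : (n : ℝ) ≤ m * (∑ i, x i - t) :=
      (div_le_iff₀ (sub_pos.2 hxt)).1 (hN.trans (by exact_mod_cast hm))
    rcases Nat.eq_zero_or_pos n with hn | hn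
    · subst hn
      simp at hxt
      exact absurd hxt (not_lt.2 (Nat.cast_nonneg t))
    · have h3 : ∑ i, (m : ℝ) * x i < ∑ i, ((⌊(m : ℝ) * x i⌋₊ : ℝ) + 1) :=
        Finset.sum_lt_sum_of_nonempty ⟨⟨0, hn⟩, Finset.mem_univ _⟩
          fun i _ => Nat.lt_floor_add_one _
      rw [← Finset.mul_sum, Finset.sum_add_distrib, Finset.sum_const, Finset.card_univ,
        Fintype.card_fin, nsmul_eq_mul, mul_one] at h3
      linarith

theorem limitingShape_eq (E : ℕ → Set (Fin n → ℕ)) :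
    limitingShape E = closure ({x : Fin n → ℝ | ∀ i, 0 ≤ x i} \ ⋃ m, scaledHull E m) := by
  have : Nonempty {m : ℕ // 1 ≤ m} := ⟨⟨1, le_rfl⟩⟩
  rw [limitingShape, Set.sdiff_iUnion]

/-- The normalized number of lattice points outside a graded family converges to the volume of the
limiting shape. -/
theorem IsGradedFamily.tendsto_ncard (hE : IsGradedFamily E) (t : ℕ) :
    Tendsto (fun m : ℕ => ((outsidePoints E t m).ncard : ℝ) / (m : ℝ) ^ n) atTop
      (𝓝 (volume (limitingShape E ∩ simplexT n t)).toReal) := by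
  have hbd : volume (Set.Icc (0 : Fin n → ℝ) fun _ => (t : ℝ) + 1) ≠ ⊤ :=
    isCompact_Icc.measure_ne_top
  have hsub : limitingShape E ∩ simplexT n t ⊆ Set.Icc (0 : Fin n → ℝ) fun _ => (t : ℝ) + 1 := by
    rintro x ⟨-, hx, hxt⟩
    refine ⟨hx, fun i => ?_⟩
    have := Finset.single_le_sum (fun i _ => hx i) (Finset.mem_univ i)
    linarith
  have hmeas : MeasurableSet (limitingShape E ∩ simplexT n t) :=
    (isClosed_closure.inter (isClosed_simplexT _)).measurableSet
  have hae : ∀ᵐ x : Fin n → ℝ, x ∉ frontier (⋃ m, scaledHull E m) :=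
    measure_eq_zero_iff_ae_notMem.1 (hE.convex_iUnion.addHaar_frontier volume)
  -- Off the null frontier, membership in the cubes eventually stabilizes. The index is shifted by
  -- one because boundedness and measurability of `cubes` are available for m ≥ 1.
  have hlim : ∀ᵐ x : Fin n → ℝ, ∀ᶠ m : ℕ in atTop,
      x ∈ cubes E t (m + 1) ↔ x ∈ limitingShape E ∩ simplexT n t := by
    filter_upwards [hae] with x hx
    refine (tendsto_add_atTop_nat 1).eventually (p := fun m =>
      x ∈ cubes E t m ↔ x ∈ limitingShape E ∩ simplexT n t) ?_
    by_cases hx0 : ∀ i, 0 ≤ x i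
    · by_cases hxU : x ∈ ⋃ m, scaledHull E m
      · have hint : x ∈ interior (⋃ m, scaledHull E m) := by
          by_contra hni
          exact hx ⟨subset_closure hxU, hni⟩
        filter_upwards [hE.eventually_floor_mem hint] with m hm
        refine iff_of_false (fun h => h.2.2 hm) fun h => ?_
        have h1 := h.1
        rw [limitingShape_eq] at h1
        obtain ⟨y, hy, hy'⟩ := mem_closure_iff.1 h1 _ isOpen_interior hint
        exact hy'.2 (interior_subset hy)
      · filter_upwards [eventually_sum_floor_le_iff hx0 t, eventually_ge_atTop 1] with m hm hm1
        have h1 : x ∈ limitingShape E := by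
          rw [limitingShape_eq]
          exact subset_closure ⟨hx0, hxU⟩
        have h2 := floor_notMem_of_notMem_iUnion hx0 hxU hm1
        constructor
        · exact fun h => ⟨h1, hm.1 h.2.1⟩
        · exact fun h => ⟨hx0, hm.2 h.2, h2⟩
    · exact Eventually.of_forall fun m => iff_of_false (fun h => hx0 h.1) fun h => hx0 h.2.1
  have hconv := tendsto_measure_of_ae_tendsto_indicator (μ := volume) atTop hmeas
    (fun m => measurableSet_cubes E t (Nat.succ_le_succ (Nat.zero_le m))) measurableSet_Icc hbd
    (Eventually.of_forall fun m => cubes_subset E t (Nat.succ_le_succ (Nat.zero_le m))) hlim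
  rw [← tendsto_add_atTop_iff_nat 1]
  have hne : volume (limitingShape E ∩ simplexT n t) ≠ ⊤ :=
    ne_top_of_le_ne_top hbd (measure_mono hsub)
  refine ((ENNReal.tendsto_toReal hne).comp hconv).congr fun m => ?_
  exact volume_cubes E t (Nat.succ_le_succ (Nat.zero_le m))

end GradedFamily

/-! ### Generic initial ideals of symbolic powers as a graded family -/

section Assembly

open MvPolynomial

variable {k : Type*} [Field k] {n : ℕ}

/-- The exponents of the monomials of `gin(I^(m))` after setting the last variable to one. -/
def ginFamily (I : Ideal (CoordRing k n)) (m : ℕ) : Set (Fin n → ℕ) :=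
  {a | ∃ α : Fin (n + 1) →₀ ℕ, monomial α 1 ∈ genericInitialIdeal (symbolicPower I m) ∧
    ∀ i : Fin n, α i.castSucc ≤ a i}

theorem orthants_ginFamily (I : Ideal (CoordRing k n)) (m : ℕ) :
    orthants (ginFamily I m) = limitSet I m := by
  ext x
  constructor
  · rintro ⟨a, ⟨α, hα, hαa⟩, hax⟩
    exact ⟨α, hα, fun i => (Nat.cast_le.2 (hαa i)).trans (hax i)⟩
  · rintro ⟨α, hα, hαx⟩
    exact ⟨fun i => α i.castSucc, ⟨α, hα, fun _ => le_rfl⟩, hαx⟩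

theorem limitingShape_ginFamily (I : Ideal (CoordRing k n)) :
    limitingShape (ginFamily I) = Gamma I := by
  simp only [limitingShape, scaledHull, orthants_ginFamily, Gamma]

theorem isGradedFamily_ginFamily (I : Ideal (CoordRing k n)) : IsGradedFamily (ginFamily I) where
  mem_of_le := by
    rintro m a b ⟨α, hα, hαa⟩ hab
    exact ⟨α, hα, fun i => (hαa i).trans (hab i)⟩
  add_mem := by
    rintro m l a b ⟨α, hα, hαa⟩ ⟨β, hβ, hβb⟩
    exact ⟨α + β, monomial_mem_genericInitialIdeal_mul (symbolicPower_mul_le I m l) hα hβ,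
      fun i => add_le_add (hαa i) (hβb i)⟩
  antitone := by
    rintro m l hml a ⟨α, hα, hαa⟩
    exact ⟨α, monomial_mem_genericInitialIdeal_mono (symbolicPower_antitone I hml) hα, hαa⟩
  zero_mem := by
    refine ⟨0, monomial_mem_genericInitialIdeal.2 (.of_forall fun g =>
      monomial_mem_initialIdeal.2 ⟨1, ?_, ?_, fun β hβ hne => absurd ?_ hne⟩), fun i => le_rfl⟩
    · rw [← map_one (coordChange g)]
      exact Ideal.mem_map_of_mem _ (pow_le_symbolicPower I 0 (by simp))
    · simp
    · rw [mem_support_iff, coeff_one] at hβ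
      exact (ite_ne_right_iff.1 hβ).1.symm

theorem monomial_mem_pow {K : Ideal (CoordRing k n)} (hK : ∀ i, X i ∈ K)
    (α : Fin (n + 1) →₀ ℕ) : monomial α 1 ∈ K ^ α.degree := by
  rw [monomial_eq, C_1, one_mul, Finsupp.degree_apply, ← Finset.prod_pow_eq_pow_sum]
  exact Ideal.prod_mem_prod fun i _ => Ideal.pow_mem_pow (hK i) _

/-- The degenerate case without saturation: powers of the ideal of all variables are unchanged by
coordinate changes, and they already contain the monomial. -/
theorem monomial_mem_genericInitialIdeal_of_forall_X_mem {I : Ideal (CoordRing k n)}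
    (hI : ∀ i, X i ∈ I) {m : ℕ} {α : Fin (n + 1) →₀ ℕ} (hα : m ≤ α.degree) :
    monomial α 1 ∈ genericInitialIdeal (symbolicPower I m) := by
  refine monomial_mem_genericInitialIdeal.2 (.of_forall fun g =>
    monomial_mem_initialIdeal.2 ⟨monomial α 1, ?_, ?_, fun β hβ hne => absurd ?_ hne⟩)
  · refine Ideal.map_mono (pow_le_symbolicPower I m) ?_
    rw [Ideal.map_pow]
    refine Ideal.pow_le_pow_right hα (monomial_mem_pow (fun i => ?_) α)
    rw [mem_map_coordChange, coordChange_X]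
    exact I.sum_mem fun j _ => I.mul_mem_left _ (hI j)
  · simp [mem_support_iff]
  · rw [mem_support_iff, coeff_monomial] at hβ
    exact (ite_ne_right_iff.1 hβ).1.symm

/-- Normally the last variable can be stripped from a monomial of gin one factor at a time, so its
exponent is irrelevant. The degree bound serves the case where the irrelevant ideal is an associated
prime. -/
theorem monomial_mem_genericInitialIdeal_iff [Infinite k] {I : Ideal (CoordRing k n)}
    (hI : ContainsComponents I) (hrad : I.IsRadical) {m : ℕ} {α : Fin (n + 1) →₀ ℕ}
    (hα : m ≤ α.degree) :
    monomial α 1 ∈ genericInitialIdeal (symbolicPower I m) ↔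
      (fun i : Fin n => α i.castSucc) ∈ ginFamily I m := by
  refine ⟨fun h => ⟨α, h, fun _ => le_rfl⟩, ?_⟩
  rintro ⟨β, hβ, hβα⟩
  by_cases hX : ∀ Q ∈ associatedPrimes (CoordRing k n) (CoordRing k n ⧸ I), ∃ j, X j ∉ Q
  · have hstrip : ∀ (c : ℕ) (γ : Fin (n + 1) →₀ ℕ),
        monomial (Finsupp.single (Fin.last n) c + γ) 1 ∈
          genericInitialIdeal (symbolicPower I m) →
        monomial γ 1 ∈ genericInitialIdeal (symbolicPower I m) := by
      intro c
      induction c with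
      | zero => intro γ h; simpa using h
      | succ c ih =>
        intro γ h
        refine ih γ (monomial_mem_genericInitialIdeal_of_add_single (hI.symbolicPower m)
          (forGenericGL_saturated hX m) ?_)
        rwa [← add_assoc, ← Finsupp.single_add, add_comm 1 c]
    have hβ' := hstrip (β (Fin.last n)) (β.erase (Fin.last n))
      (by rwa [Finsupp.single_add_erase])
    refine monomial_mem_of_le (fun i => ?_) hβ'
    induction i using Fin.lastCases with
    | last => simp
    | cast i =>
      rw [Finsupp.erase_ne (Fin.castSucc_lt_last i).ne]
      exact hβα i
  · push Not at hX
    obtain ⟨Q, hQ, hXQ⟩ := hX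
    exact monomial_mem_genericInitialIdeal_of_forall_X_mem
      (X_mem_of_forall_X_mem_associatedPrime hI hrad hQ hXQ) hα

/-- Forgetting the last exponent is a bijection, since the total degree mt restores it. The
condition t ≥ 1 gives mt ≥ m, as the membership criterion requires. -/
theorem hilbertFunction_symbolicPower [Infinite k] {I : Ideal (CoordRing k n)}
    (hI : ContainsComponents I) (hrad : I.IsRadical) {t : ℕ} (ht : 1 ≤ t) (m : ℕ) :
    hilbertFunction (symbolicPower I m) (m * t) = (outsidePoints (ginFamily I) t m).ncard := by
  classical
  have hmt : m ≤ m * t := Nat.le_mul_of_pos_right m ht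
  rw [hilbertFunction_eq_card (hI.symbolicPower m), ← Set.ncard_coe_finset]
  have hsum : ∀ α : Fin (n + 1) →₀ ℕ,
      α.degree = ∑ i : Fin n, α i.castSucc + α (Fin.last n) := fun α => by
    rw [Finsupp.degree_eq_sum, Fin.sum_univ_castSucc]
  refine Set.ncard_congr (fun α _ i => α.1 i.castSucc) ?_ ?_ ?_
  · intro α hα
    rw [Finset.mem_coe, Finset.mem_filter,
      monomial_mem_genericInitialIdeal_iff hI hrad (hmt.trans α.2.ge)] at hα
    refine ⟨?_, hα.2⟩
    change ∑ i : Fin n, α.1 i.castSucc ≤ m * t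
    have h1 := hsum α.1
    rw [α.2] at h1
    omega
  · intro α β _ _ hαβ
    have h1 := hsum α.1
    have h2 := hsum β.1
    have h3 : ∀ i : Fin n, α.1 i.castSucc = β.1 i.castSucc := fun i => congrFun hαβ i
    rw [α.2, Finset.sum_congr rfl fun i _ => h3 i] at h1
    rw [β.2] at h2
    refine Subtype.ext (Finsupp.ext fun i => ?_)
    induction i using Fin.lastCases with
    | last => omega
    | cast i => exact h3 i
  · rintro a ⟨ha, haE⟩
    let α : Fin (n + 1) →₀ ℕ := Finsupp.equivFunOnFinite.symm
      (Fin.snoc (α := fun _ => ℕ) a (m * t - ∑ i, a i))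
    have hα : ∀ i : Fin n, α i.castSucc = a i := fun i => by simp [α]
    have hd : α.degree = m * t := by
      rw [hsum, Finset.sum_congr rfl fun i _ => hα i]
      have : α (Fin.last n) = m * t - ∑ i, a i := by simp [α]
      rw [this, Nat.add_sub_cancel' ha]
    refine ⟨⟨α, hd⟩, ?_, funext hα⟩
    refine Finset.mem_coe.2 (Finset.mem_filter.2 ⟨Finset.mem_univ _, fun h => haE ?_⟩)
    have h1 := (monomial_mem_genericInitialIdeal_iff hI hrad (hmt.trans hd.ge)).1 h
    rwa [funext hα] at h1

theorem tendsto_aHFSeq [Infinite k] {I : Ideal (CoordRing k n)}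
    (hI : ContainsComponents I) (hrad : I.IsRadical) {t : ℕ} (ht : 1 ≤ t) :
    Tendsto (aHFSeq I t) atTop (𝓝 (volume (Gamma I ∩ simplexT n t)).toReal) := by
  have h := (isGradedFamily_ginFamily I).tendsto_ncard t
  rw [limitingShape_ginFamily] at h
  refine h.congr fun m => ?_
  rw [aHFSeq, hilbertFunction_symbolicPower hI hrad ht]

theorem aHPSeq_eq_aHFSeq {I : Ideal (CoordRing k n)} {m t : ℕ} {c : ℝ}
    (hreg : regularity (symbolicPower I m) ≤ (c : EReal)) (h : c < (m : ℝ) * t) :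
    aHPSeq I t m = aHFSeq I t m := by
  have h1 := (eval_hilbertPolynomial_eq hreg).2 (m * t) (by exact_mod_cast h)
  rw [aHPSeq, aHFSeq]
  congr 1
  have h2 := Polynomial.aeval_algebraMap_apply ℝ ((m * t : ℕ) : ℚ)
    (hilbertPolynomial (symbolicPower I m))
  rw [Polynomial.coe_aeval_eq_eval, h1, map_natCast, map_natCast, Nat.cast_mul] at h2
  exact h2

/-- Lagrange interpolation of the rescaled Hilbert polynomials. -/
theorem aHPSeq_eq_sum {I : Ideal (CoordRing k n)} {m : ℕ} {c : ℝ}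
    (hreg : regularity (symbolicPower I m) ≤ (c : EReal)) (v : ℕ → ℝ)
    (hv : Function.Injective v) (t : ℝ) :
    aHPSeq I t m = ∑ i ∈ Finset.range (n + 1),
      aHPSeq I (v i) m * (Lagrange.basis (Finset.range (n + 1)) v i).eval t := by
  let Q : Polynomial ℝ := Polynomial.C (((m : ℝ) ^ n)⁻¹) *
    ((hilbertPolynomial (symbolicPower I m)).map (algebraMap ℚ ℝ)).comp
      (Polynomial.C (m : ℝ) * Polynomial.X)
  have hQ : ∀ s, Q.eval s = aHPSeq I s m := by
    intro s
    rw [aHPSeq, Polynomial.eval_mul, Polynomial.eval_C, Polynomial.eval_comp,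
      Polynomial.eval_mul, Polynomial.eval_C, Polynomial.eval_X, Polynomial.eval_map_algebraMap]
    ring
  have hdeg : Q.degree < (Finset.range (n + 1)).card := by
    rw [Finset.card_range]
    have h1 : (hilbertPolynomial (symbolicPower I m)).natDegree ≤ n := by
      by_cases h0 : hilbertPolynomial (symbolicPower I m) = 0
      · simp [h0]
      · exact Nat.lt_succ_iff.1 ((Polynomial.natDegree_lt_iff_degree_lt h0).2
          (eval_hilbertPolynomial_eq hreg).1)
    have h2 : Q.natDegree ≤ n := by
      refine (Polynomial.natDegree_C_mul_le _ _).trans (Polynomial.natDegree_comp_le.trans ?_)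
      have h3 : (Polynomial.C (m : ℝ) * Polynomial.X).natDegree ≤ 1 :=
        (Polynomial.natDegree_C_mul_le _ _).trans Polynomial.natDegree_X_le
      have h4 : ((hilbertPolynomial (symbolicPower I m)).map (algebraMap ℚ ℝ)).natDegree ≤ n :=
        Polynomial.natDegree_map_le.trans h1
      simpa using Nat.mul_le_mul h4 h3
    refine (Polynomial.degree_le_of_natDegree_le h2).trans_lt ?_
    exact_mod_cast Nat.lt_succ_self n
  rw [← hQ, Lagrange.eq_interpolate (hv.injOn) hdeg, Lagrange.interpolate_apply,
    Polynomial.eval_finsetSum]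
  refine Finset.sum_congr rfl fun i _ => ?_
  rw [Polynomial.eval_mul, Polynomial.eval_C, hQ]

end Assembly

end AsymptoticHilbert

end

theorem mainTheorem3 {k : Type*} [Field k] [IsAlgClosed k] [CharZero k] (n : ℕ)
    (I : Ideal (AsymptoticHilbert.CoordRing k n))
    (hhom : I.IsHomogeneous (MvPolynomial.homogeneousSubmodule (Fin (n + 1)) k))
    (hrad : I.IsRadical) (hreg : AsymptoticHilbert.IsLBSR I) :
    (∀ t : ℝ, Tendsto (AsymptoticHilbert.aHPSeq I t) atTop (𝓝 (AsymptoticHilbert.aHP I t))) ∧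
    ∀ᶠ t : ℕ in atTop,
      Tendsto (AsymptoticHilbert.aHFSeq I t) atTop (𝓝 (AsymptoticHilbert.aHF I t)) ∧
      AsymptoticHilbert.aHP I t = AsymptoticHilbert.aHF I t ∧
      AsymptoticHilbert.aHP I t =
        (volume (AsymptoticHilbert.Gamma I ∩ AsymptoticHilbert.simplexT n t)).toReal := by
  open AsymptoticHilbert in
  have : Infinite k := CharZero.infinite k
  have hI := containsComponents_of_isHomogeneous hhom
  obtain ⟨a, b, ha, hb, hab⟩ := hreg
  -- For m ≥ 1 and t ≥ T one has am + b ≤ (a + b)m < mt, so degree mt lies above the regularity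
  -- bound.
  obtain ⟨T, hT⟩ := exists_nat_gt (a + b)
  have hT1 : 1 ≤ T := by
    have : (0 : ℝ) < T := (add_pos ha hb).trans hT
    exact_mod_cast this
  have hHP : ∀ t : ℕ, T ≤ t →
      Tendsto (aHPSeq I t) atTop (𝓝 (volume (Gamma I ∩ simplexT n t)).toReal) := by
    intro t ht
    refine (tendsto_aHFSeq hI hrad (hT1.trans ht)).congr' ?_
    filter_upwards [hab, eventually_ge_atTop 1] with m hm hm1
    refine (aHPSeq_eq_aHFSeq hm ?_).symm
    have h1 : (1 : ℝ) ≤ m := by exact_mod_cast hm1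
    have h2 : (T : ℝ) ≤ t := by exact_mod_cast ht
    nlinarith
  refine ⟨fun t => tendsto_nhds_limUnder ?_, ?_⟩
  -- Interpolation nodes T, …, T + n: convergence is known at each of them, and the Lagrange weights
  -- at t do not depend on m.
  · refine ⟨_, (tendsto_finsetSum (Finset.range (n + 1)) fun i _ =>
      (hHP (T + i) (Nat.le_add_right T i)).mul_const
        ((Lagrange.basis (Finset.range (n + 1)) (fun i : ℕ => ((T + i : ℕ) : ℝ)) i).eval t)).congr'
          ?_⟩
    filter_upwards [hab] with m hm
    exact (aHPSeq_eq_sum hm (fun i : ℕ => ((T + i : ℕ) : ℝ))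
      (fun i j hij => Nat.add_left_cancel (Nat.cast_injective hij)) t).symm
  · filter_upwards [eventually_ge_atTop T] with t ht
    have h1 := tendsto_aHFSeq hI hrad (hT1.trans ht)
    have h2 : aHF I t = _ := h1.limUnder_eq
    have h3 : aHP I t = _ := (hHP t ht).limUnder_eq
    rw [h2, h3]
    exact ⟨h1, rfl, rfl⟩
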